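/- Let $\sigma_d$ be the uniform probability measure on the unit sphere of $\mathbb C^d$. A POVM $\mathrm M$ on $\mathbb C^d$ is a $\sigma$-additive map from a $\sigma$-algebra $\mathcal F$ on a set $\Omega$ to the positive operators on $\mathbb C^d$ with $\mathrm M(\Omega)=\mathrm{Id}$; its distinguishability norm is, for Hermitian $\Delta$, $\|\Delta\|_{\mathrm M}=\sup_{A\in\mathcal F}\big[\operatorname{tr}(\Delta\,\mathrm M(A))-\operatorname{tr}(\Delta\,\mathrm M(\Omega\setminus A))\big]$, which for a discrete POVM $\mathrm M=(M_j)_{1\le j\le n}$ equals $\sum_j|\operatorname{tr}(\Delta M_j)|$. The uniform POVM is $\mathrm U_d(A)=d\int_A|\psi\rangle\langle\psi|\,d\sigma_d(\psi)$, and the local uniform POVM on $\mathbb C^{d_1}\otimes\cdots\otimes\mathbb C^{d_k}$ is the tensor product $\mathrm{LU}=\mathrm U_{d_1}\otimes\cdots\otimes\mathrm U_{d_k}$, defined on the product $\sigma$-algebra. For unit vectors $\psi_1,\dots,\psi_n\in\mathbb C^d$ put $P_j=|\psi_j\rangle\langle\psi_j|$ and $S=P_1+\cdots+P_n$; when $S$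 is invertible, $(S^{-1/2}P_jS^{-1/2})_{1\le j\le n}$ is a discrete POVM. Theorem 5.3. There is a universal constant $C>0$ and, for every $0<\varepsilon<1$, a constant $c(\varepsilon)>0$ depending only on $\varepsilon$, such that the following holds. Let $k\ge 1$, $d_1,\dots,d_k\ge 1$ and $$n_i\ \ge\ C\,\varepsilon^{-2}\max(1,|\log\varepsilon|)\,d_i^2\qquad(1\le i\le k).$$ Let $\psi^{(i)}_j$ ($1\le i\le k$, $1\le j\le n_i$) be independent random vectors, $\psi^{(i)}_j$ being uniformly distributed on the unit sphere of $\mathbb C^{d_i}$, and let $\mathrm M_i$ be the family $(S^{-1/2}P_jS^{-1/2})_{1\le j\le n_i}$ built from $\psi^{(i)}_1,\dots,\psi^{(i)}_{n_i}$. Then, except on an event of probability less than $$1-\prod_{i=1}^k\big(1-e^{-c(\varepsilon)d_i}\big)\ \Big(\le\sum_{i=1}^k e^{-c(\varepsilon)d_i}\Big),$$ every $\mathrm M_i$ is a discrete POVM on $\mathbb C^{d_i}$, and for every Hermitian operator $\Delta$ on $\mathbb C^{d_1}\otimes\cdots\otimes\mathbb C^{d_k}$, $$(1-\varepsilon)^k\|\Delta\|_{\mathrm{LU}}\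 \le\ \|\Delta\|_{\mathrm M_1\otimes\cdots\otimes\mathrm M_k}\ \le\ (1+\varepsilon)^k\|\Delta\|_{\mathrm{LU}}.$$ -/

import Mathlib

open MeasureTheory ProbabilityTheory Metric Matrix
open scoped ComplexOrder

noncomputable section

/-! ### POVMs and distinguishability norms -/

/-- A (not necessarily discrete) POVM on the Hilbert space `ℂ^ι`, defined on the `σ`-algebra of the
measurable space `Ω`: a `σ`-additive map from measurable sets to positive operators whose value on
the whole space is the identity. -/
structure POVM (Ω : Type*) [MeasurableSpace Ω] (ι : Type*) [Fintype ι] [DecidableEq ι] where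
  toVectorMeasure : VectorMeasure Ω (Matrix ι ι ℂ)
  posSemidef : ∀ A, MeasurableSet A → (toVectorMeasure A).PosSemidef
  map_univ : toVectorMeasure Set.univ = 1

/-- The distinguishability norm of a POVM, i.e. the total variation of `tr (Δ M(·))`:
the supremum over measurable `A` of `tr (Δ M(A)) - tr (Δ M(Aᶜ))`
(a real number when `Δ` is Hermitian). -/
def POVM.distNorm {Ω : Type*} [MeasurableSpace Ω] {ι : Type*} [Fintype ι] [DecidableEq ι]
    (M : POVM Ω ι) (Δ : Matrix ι ι ℂ) : ℝ :=
  ⨆ A : {A : Set Ω // MeasurableSet A},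
    ((Δ * M.toVectorMeasure A.1).trace - (Δ * M.toVectorMeasure (A.1)ᶜ).trace).re

/-- A finite family of operators is a discrete POVM if its elements are positive and sum to `1`. -/
def IsDiscretePOVM {J ι : Type*} [Fintype J] [Fintype ι] [DecidableEq ι]
    (M : J → Matrix ι ι ℂ) : Prop :=
  (∀ j, (M j).PosSemidef) ∧ ∑ j, M j = 1

/-- The distinguishability norm of a discrete POVM: `∑ j, |tr (Δ M_j)|`. -/
def discreteDistNorm {J ι : Type*} [Fintype J] [Fintype ι]
    (M : J → Matrix ι ι ℂ) (Δ : Matrix ι ι ℂ) : ℝ :=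
  ∑ j, ‖(Δ * M j).trace‖

/-! ### Tensor products

The Hilbert space `ℂ^{d₁} ⊗ ⋯ ⊗ ℂ^{d_k}` is identified, through its product basis, with the space
indexed by multi-indices `(i : Fin k) → Fin (d i)`. -/

/-- The tensor (Kronecker) product `A₁ ⊗ ⋯ ⊗ A_k` of a finite family of matrices. -/
def tensorMatrix {k : ℕ} {d : Fin k → ℕ} (A : ∀ i, Matrix (Fin (d i)) (Fin (d i)) ℂ) :
    Matrix (∀ i, Fin (d i)) (∀ i, Fin (d i)) ℂ :=
  Matrix.of fun a b => ∏ i, A i (a i) (b i)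

/-- The tensor product of discrete POVMs: its elements are all `M₁(j₁) ⊗ ⋯ ⊗ M_k(j_k)`. -/
def tensorFamily {k : ℕ} {d : Fin k → ℕ} {J : Fin k → Type*}
    (M : ∀ i, J i → Matrix (Fin (d i)) (Fin (d i)) ℂ) :
    (∀ i, J i) → Matrix (∀ i, Fin (d i)) (∀ i, Fin (d i)) ℂ :=
  fun j => tensorMatrix fun i => M i (j i)

/-- `N` is the tensor product `M₁ ⊗ ⋯ ⊗ M_k` of general POVMs: it lives on the product
`σ`-algebra and `N (A₁ × ⋯ × A_k) = M₁(A₁) ⊗ ⋯ ⊗ M_k(A_k)`. -/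
def IsTensorPOVM {k : ℕ} {d : Fin k → ℕ} {Ω : Fin k → Type*} [∀ i, MeasurableSpace (Ω i)]
    (M : ∀ i, POVM (Ω i) (Fin (d i))) (N : POVM (∀ i, Ω i) (∀ i, Fin (d i))) : Prop :=
  ∀ A : ∀ i, Set (Ω i), (∀ i, MeasurableSet (A i)) →
    N.toVectorMeasure (Set.univ.pi A) = tensorMatrix fun i => (M i).toVectorMeasure (A i)

/-! ### The POVM with a given operator-valued density -/

open Classical in
/-- The operator-valued measure `A ↦ ∫_A F dμ`; the integral of a matrix is taken entrywise. -/
def densityVectorMeasure {Ω : Type*} [MeasurableSpace Ω] {ι : Type*}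
    (μ : Measure Ω) (F : Ω → Matrix ι ι ℂ) (hF : ∀ a b, Integrable (fun ω => F ω a b) μ) :
    VectorMeasure Ω (Matrix ι ι ℂ) where
  measureOf' A := if MeasurableSet A then Matrix.of fun a b => ∫ ω in A, F ω a b ∂μ else 0
  empty' := by
    ext a b
    simp
  not_measurable' A hA := if_neg hA
  m_iUnion' f hf hd := by
    simp only [hf, MeasurableSet.iUnion hf, if_true]
    refine Pi.hasSum.2 fun a => Pi.hasSum.2 fun b => ?_
    exact hasSum_integral_iUnion hf hd (hF a b).integrableOn

open Classical in
theorem densityVectorMeasure_apply {Ω : Type*} [MeasurableSpace Ω] {ι : Type*}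
    (μ : Measure Ω) (F : Ω → Matrix ι ι ℂ) (hF : ∀ a b, Integrable (fun ω => F ω a b) μ)
    {A : Set Ω} (hA : MeasurableSet A) (a b : ι) :
    densityVectorMeasure μ F hF A a b = ∫ ω in A, F ω a b ∂μ := by
  change (if MeasurableSet A then Matrix.of fun a b => ∫ ω in A, F ω a b ∂μ else 0) a b = _
  simp [hA]

/-- The POVM `A ↦ ∫_A F dμ` attached to a positive operator-valued density `F`
with `∫ F dμ = 1`. -/
def POVM.ofDensity {Ω : Type*} [MeasurableSpace Ω] {ι : Type*} [Fintype ι] [DecidableEq ι]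
    (μ : Measure Ω) (F : Ω → Matrix ι ι ℂ) (hF : ∀ a b, Integrable (fun ω => F ω a b) μ)
    (hpos : ∀ ω, (F ω).PosSemidef)
    (hone : ∀ a b, ∫ ω, F ω a b ∂μ = (1 : Matrix ι ι ℂ) a b) : POVM Ω ι where
  toVectorMeasure := densityVectorMeasure μ F hF
  posSemidef A hA := by
    refine Matrix.PosSemidef.of_dotProduct_mulVec_nonneg ?_ fun x => ?_
    · ext a b
      rw [Matrix.conjTranspose_apply, densityVectorMeasure_apply μ F hF hA,
        densityVectorMeasure_apply μ F hF hA, RCLike.star_def, ← integral_conj]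
      refine integral_congr_ae (Filter.Eventually.of_forall fun ω => ?_)
      have := (hpos ω).isHermitian.apply a b
      simpa using this
    · have key : star x ⬝ᵥ (densityVectorMeasure μ F hF A).mulVec x
          = ∫ ω in A, star x ⬝ᵥ (F ω).mulVec x ∂μ := by
        simp only [dotProduct, Matrix.mulVec]
        rw [integral_finsetSum]
        · refine Finset.sum_congr rfl fun a _ => ?_
          rw [integral_const_mul, integral_finsetSum]
          · congr 1
            refine Finset.sum_congr rfl fun b _ => ?_
            rw [integral_mul_const, densityVectorMeasure_apply μ F hF hA]
          · exact fun b _ => (hF a b).integrableOn.mul_const _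
        · exact fun a _ => (integrable_finsetSum _ fun b _ =>
            (hF a b).integrableOn.mul_const _).const_mul _
      rw [key]
      exact integral_nonneg fun ω => (hpos ω).dotProduct_mulVec_nonneg x
  map_univ := by
    ext a b
    rw [densityVectorMeasure_apply μ F hF MeasurableSet.univ, Measure.restrict_univ, hone]

/-! ### The uniform measure on the unit sphere of `ℂ^d` -/

/-- The unit sphere of `ℂ^d`. -/
abbrev CSphere (d : ℕ) : Type := sphere (0 : EuclideanSpace ℂ (Fin d)) 1

/-- The uniform (Haar) probability measure on the unit sphere of `ℂ^d`, `d ≥ 1`: the normalized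
surface measure. -/
def uniformSphere (d : ℕ) : Measure (CSphere d) :=
  ((volume : Measure (EuclideanSpace ℂ (Fin d))).toSphere Set.univ)⁻¹ •
    (volume : Measure (EuclideanSpace ℂ (Fin d))).toSphere

/-- The rank one operator `|ψ⟩⟨ψ|`. -/
def rankOne {d : ℕ} (ψ : EuclideanSpace ℂ (Fin d)) : Matrix (Fin d) (Fin d) ℂ :=
  vecMulVec ψ.ofLp (star ψ.ofLp)

instance uniformSphere_isFinite (d : ℕ) : IsFiniteMeasure (uniformSphere d) where
  measure_univ_lt_top := by
    rw [uniformSphere, Measure.smul_apply, smul_eq_mul]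
    exact lt_of_le_of_lt (ENNReal.inv_mul_le_one _) ENNReal.one_lt_top

instance uniformSphere_isProbability (d : ℕ) [NeZero d] :
    IsProbabilityMeasure (uniformSphere d) where
  measure_univ := by
    rw [uniformSphere, Measure.smul_apply, smul_eq_mul]
    refine ENNReal.inv_mul_cancel ?_ (measure_ne_top _ _)
    rw [Ne, Measure.measure_univ_eq_zero]
    exact Measure.toSphere_ne_zero _

theorem sphere_coord_le {d : ℕ} (ψ : CSphere d) (a : Fin d) : ‖ψ.1 a‖ ≤ 1 := by
  have h := PiLp.norm_apply_le ψ.1 a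
  rwa [norm_eq_of_mem_sphere ψ] at h

theorem measurable_sphere_coord {d : ℕ} (a : Fin d) : Measurable fun ψ : CSphere d => ψ.1 a := by
  have : Continuous fun ψ : CSphere d => ψ.1 a := by fun_prop
  exact this.measurable

theorem uniformSphere_map {d : ℕ} (L : EuclideanSpace ℂ (Fin d) ≃ₗᵢ[ℝ] EuclideanSpace ℂ (Fin d)) :
    MeasurePreserving (fun ψ : CSphere d => (⟨L ψ.1, by simp⟩ : CSphere d))
      (uniformSphere d) (uniformSphere d) := by
  have hm : Measurable (fun ψ : CSphere d => (⟨L ψ.1, by simp⟩ : CSphere d)) := by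
    have : Continuous (fun ψ : CSphere d => (⟨L ψ.1, by simp⟩ : CSphere d)) := by fun_prop
    exact this.measurable
  refine ⟨hm, ?_⟩
  rw [uniformSphere, Measure.map_smul]
  congr 1
  ext s hs
  rw [Measure.map_apply hm hs, Measure.toSphere_apply' _ (hm hs), Measure.toSphere_apply' _ hs]
  congr 1
  conv_rhs =>
    rw [← (L.measurePreserving).measure_preimage_emb L.toHomeomorph.measurableEmbedding]
  congr 1
  ext x
  simp only [Set.mem_smul, Set.mem_preimage, Set.mem_image]
  constructor
  · rintro ⟨r, hr, _, ⟨ψ, hψ, rfl⟩, h⟩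
    exact ⟨r, hr, _, ⟨_, hψ, rfl⟩, by simp [← h]⟩
  · rintro ⟨r, hr, _, ⟨ψ, hψ, rfl⟩, h⟩
    refine ⟨r, hr, L.symm ψ.1, ⟨⟨L.symm ψ.1, by simp⟩, ?_, rfl⟩, ?_⟩
    · simpa using hψ
    · apply L.injective
      simp [h]

theorem integrable_rankOne {d : ℕ} (a b : Fin d) :
    Integrable (fun ψ : CSphere d => rankOne ψ.1 a b) (uniformSphere d) := by
  refine Integrable.of_bound (C := 1) ?_ (Filter.Eventually.of_forall fun ψ => ?_)
  · exact ((measurable_sphere_coord a).mul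
      (continuous_star.measurable.comp (measurable_sphere_coord b))).aestronglyMeasurable
  · simp only [rankOne, vecMulVec_apply, Pi.star_apply, norm_mul, norm_star]
    exact mul_le_one₀ (sphere_coord_le ψ a) (norm_nonneg _) (sphere_coord_le ψ b)

theorem integral_rankOne_map {d : ℕ}
    (L : EuclideanSpace ℂ (Fin d) ≃ₗᵢ[ℝ] EuclideanSpace ℂ (Fin d)) (a b : Fin d) :
    ∫ ψ, rankOne (L ψ.1) a b ∂(uniformSphere d) = ∫ ψ, rankOne ψ.1 a b ∂(uniformSphere d) := by
  have h := uniformSphere_map L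
  conv_rhs => rw [← h.map_eq]
  rw [integral_map h.measurable.aemeasurable]
  rw [h.map_eq]
  exact (integrable_rankOne a b).aestronglyMeasurable

/-- The barycentre of the pure states is the maximally mixed state: `d ∫ |ψ⟩⟨ψ| = 1`. -/
theorem integral_rankOne {d : ℕ} (a b : Fin d) :
    ∫ ψ, ((d : ℂ) • rankOne ψ.1) a b ∂(uniformSphere d) = (1 : Matrix (Fin d) (Fin d) ℂ) a b := by
  have : NeZero d := ⟨fun h => (h ▸ a).elim0⟩
  simp only [Matrix.smul_apply, smul_eq_mul]
  rw [integral_const_mul]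
  by_cases hab : a = b
  · subst hab
    have hdiag : ∀ c : Fin d, ∫ ψ, rankOne ψ.1 c c ∂(uniformSphere d)
        = ∫ ψ, rankOne ψ.1 a a ∂(uniformSphere d) := by
      intro c
      rw [← integral_rankOne_map (LinearIsometryEquiv.piLpCongrLeft 2 ℝ ℂ (Equiv.swap c a)) c c]
      refine integral_congr_ae (Filter.Eventually.of_forall fun ψ => ?_)
      simp [rankOne, vecMulVec_apply, LinearIsometryEquiv.piLpCongrLeft_apply,
        Equiv.piCongrLeft'_apply]
    have hsum : ∑ c : Fin d, ∫ ψ, rankOne ψ.1 c c ∂(uniformSphere d) = 1 := by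
      rw [← integral_finsetSum _ fun c _ => integrable_rankOne c c]
      have : ∀ ψ : CSphere d, ∑ c : Fin d, rankOne ψ.1 c c = 1 := by
        intro ψ
        have h1 : ‖ψ.1‖ ^ 2 = 1 := by rw [norm_eq_of_mem_sphere ψ]; norm_num
        rw [EuclideanSpace.norm_sq_eq] at h1
        have h2 : ((∑ c, ‖ψ.1 c‖ ^ 2 : ℝ) : ℂ) = 1 := by rw [h1]; simp
        rw [← h2]
        push_cast
        refine Finset.sum_congr rfl fun c _ => ?_
        simp [rankOne, vecMulVec_apply, Complex.mul_conj, Complex.normSq_eq_norm_sq]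
      simp [this]
    rw [Finset.sum_congr rfl fun c _ => hdiag c] at hsum
    simpa using hsum
  · have h := integral_rankOne_map (LinearIsometryEquiv.piLpCongrRight 2 fun i : Fin d =>
      if i = a then LinearIsometryEquiv.neg ℝ (E := ℂ) else LinearIsometryEquiv.refl ℝ ℂ) a b
    have h' : ∫ ψ, rankOne ψ.1 a b ∂(uniformSphere d)
        = -∫ ψ, rankOne ψ.1 a b ∂(uniformSphere d) := by
      rw [← integral_neg, ← h]
      refine integral_congr_ae (Filter.Eventually.of_forall fun ψ => ?_)
      simp [rankOne, vecMulVec_apply, Ne.symm hab]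
    rw [Matrix.one_apply_ne hab, self_eq_neg.1 h', mul_zero]

/-! ### The uniform POVM and the local uniform POVM -/

theorem posSemidef_smul_rankOne {d : ℕ} (ψ : EuclideanSpace ℂ (Fin d)) :
    ((d : ℂ) • rankOne ψ).PosSemidef :=
  (Matrix.posSemidef_vecMulVec_self_star _).smul (by positivity)

/-- The uniform POVM `U_d` on `ℂ^d`: `U_d(A) = d ∫_A |ψ⟩⟨ψ| dσ(ψ)` for `A` in the Borel
`σ`-algebra of the unit sphere. -/
def uniformPOVM (d : ℕ) : POVM (CSphere d) (Fin d) :=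
  POVM.ofDensity (uniformSphere d) (fun ψ => (d : ℂ) • rankOne ψ.1)
    (fun a b => (integrable_rankOne a b).const_mul _)
    (fun ψ => posSemidef_smul_rankOne ψ.1) integral_rankOne

theorem posSemidef_tensor_rankOne {k : ℕ} {d : Fin k → ℕ}
    (ψ : ∀ i, EuclideanSpace ℂ (Fin (d i))) :
    (tensorMatrix fun i => (d i : ℂ) • rankOne (ψ i)).PosSemidef := by
  have : (tensorMatrix fun i => (d i : ℂ) • rankOne (ψ i)) =
      (∏ i, (d i : ℂ)) • vecMulVec (fun a : ∀ i, Fin (d i) => ∏ i, ψ i (a i))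
        (star fun a : ∀ i, Fin (d i) => ∏ i, ψ i (a i)) := by
    ext a b
    simp [tensorMatrix, rankOne, vecMulVec_apply, Finset.prod_mul_distrib]
  rw [this]
  exact (Matrix.posSemidef_vecMulVec_self_star _).smul
    (Finset.prod_nonneg fun i _ => by positivity)

/-- The local uniform POVM `LU = U_{d₁} ⊗ ⋯ ⊗ U_{d_k}` on `ℂ^{d₁} ⊗ ⋯ ⊗ ℂ^{d_k}`, given by
`LU(A) = ∫_A ⨂ᵢ dᵢ |ψᵢ⟩⟨ψᵢ|` on the product of the unit spheres; `localUniformPOVM_isTensor` shows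
that it is the tensor product of the uniform POVMs. -/
def localUniformPOVM {k : ℕ} (d : Fin k → ℕ) :
    POVM (∀ i, CSphere (d i)) (∀ i, Fin (d i)) :=
  POVM.ofDensity (Measure.pi fun i => uniformSphere (d i))
    (fun ψ => tensorMatrix fun i => (d i : ℂ) • rankOne (ψ i).1)
    (fun a b => Integrable.fintype_prod_dep
      (f := fun i (ψ : CSphere (d i)) => ((d i : ℂ) • rankOne ψ.1) (a i) (b i))
      fun i => (integrable_rankOne (a i) (b i)).const_mul _)
    (fun ψ => posSemidef_tensor_rankOne fun i => (ψ i).1)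
    (fun a b => by
      simp only [tensorMatrix, Matrix.of_apply]
      rw [integral_fintype_prod_eq_prod
        (fun i (ψ : CSphere (d i)) => ((d i : ℂ) • rankOne ψ.1) (a i) (b i))]
      simp only [integral_rankOne, Matrix.one_apply, Finset.prod_ite_zero, funext_iff]
      simp)

theorem localUniformPOVM_isTensor {k : ℕ} (d : Fin k → ℕ) :
    IsTensorPOVM (fun i => uniformPOVM (d i)) (localUniformPOVM d) := by
  intro A hA
  ext a b
  simp only [localUniformPOVM, uniformPOVM, POVM.ofDensity, tensorMatrix, Matrix.of_apply]
  rw [densityVectorMeasure_apply _ _ _ (MeasurableSet.univ_pi hA), Measure.restrict_pi_pi]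
  simp only [Matrix.of_apply]
  rw [integral_fintype_prod_eq_prod
    (fun i (ψ : CSphere (d i)) => ((d i : ℂ) • rankOne ψ.1) (a i) (b i))]
  exact Finset.prod_congr rfl fun i _ => (densityVectorMeasure_apply _ _ _ (hA i) _ _).symm

/-! ### The random discrete POVM -/

/-- `S^{-1/2}` for a positive invertible matrix `S` (continuous functional calculus). -/
def invSqrt {d : ℕ} (S : Matrix (Fin d) (Fin d) ℂ) : Matrix (Fin d) (Fin d) ℂ :=
  cfc (fun x : ℝ => (Real.sqrt x)⁻¹) S

/-- The family `(S^{-1/2} Pⱼ S^{-1/2})ⱼ` attached to unit vectors `ψ₁, …, ψₙ` of `ℂ^d`, where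
`Pⱼ = |ψⱼ⟩⟨ψⱼ|` and `S = P₁ + ⋯ + Pₙ`. It is a discrete POVM exactly when `S` is invertible. -/
def normalizedFamily {d n : ℕ} (ψ : Fin n → CSphere d) : Fin n → Matrix (Fin d) (Fin d) ℂ :=
  fun j => invSqrt (∑ l, rankOne (ψ l).1) * rankOne (ψ j).1 * invSqrt (∑ l, rankOne (ψ l).1)

end

/-!
Integrating `exp (-‖x‖² + z ⟨x|Δ|x⟩)` over `ℂ^d`, once in an eigenbasis of the Hermitian matrix
`Δ` and once in polar coordinates, gives `∫ (1 - z ⟨ψ|Δ|ψ⟩)^(-d) dσ(ψ) = ∏ᵢ (1 - z λᵢ)⁻¹`. At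
`z = i` this bounds the Frobenius norm of `Δ` by the uniform norm `∫ d |⟨ψ|Δ|ψ⟩| dσ(ψ)`, and at
`z = ±1` it bounds the exponential moments of `d ⟨ψ|Δ|ψ⟩` when the uniform norm is small. So, for
each fixed `Δ`, the empirical mean of `d |⟨ψⱼ|Δ|ψⱼ⟩|` over independent uniform `ψⱼ` concentrates
around the uniform norm with a Bernstein tail; a net in the `d²`-dimensional real space of Hermitian
matrices makes this uniform in `Δ` as soon as `n` is of order `d² ε⁻² |log ε|`. The same argument
for the empirical mean of `d ⟨ψⱼ|Δ|ψⱼ⟩` shows that `(d / n) S` is close to the identity in Frobenius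
norm, so conjugating by its inverse square root changes the uniform norm only slightly. Finally, a
relative comparison of measurement norms on Hermitian matrices passes to tensor products one factor
at a time by Fubini, because contracting a Hermitian matrix against a Hermitian one on a factor
leaves a Hermitian one.
-/

noncomputable section

/-! ### The law of `⟨ψ|Δ|ψ⟩` on the unit sphere of `ℂ^d` -/

theorem integral_eq_integral_toSphere_prod {E F : Type*} [NormedAddCommGroup E] [NormedSpace ℝ E]
    [FiniteDimensional ℝ E] [Nontrivial E] [MeasurableSpace E] [BorelSpace E]
    [NormedAddCommGroup F] [NormedSpace ℝ F] (μ : Measure E) [μ.IsAddHaarMeasure] (f : E → F) :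
    ∫ x, f x ∂μ = ∫ p, f (p.2.1 • p.1.1)
      ∂(μ.toSphere.prod (Measure.volumeIoiPow (Module.finrank ℝ E - 1))) := by
  have hne : ∫ x, f x ∂μ = ∫ x : ({0}ᶜ : Set E), f x ∂(μ.comap (↑)) := by
    rw [integral_subtype_comap (measurableSet_singleton _).compl f, restrict_compl_singleton]
  rw [← μ.measurePreserving_homeomorphUnitSphereProd.integral_comp
    (Homeomorph.measurableEmbedding _), hne]
  refine integral_congr_ae (.of_forall fun x => congrArg f ?_)
  simp [smul_smul, mul_inv_cancel₀ (norm_ne_zero_iff.2 x.2)]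

theorem integrable_toSphere_prod {E F : Type*} [NormedAddCommGroup E] [NormedSpace ℝ E]
    [FiniteDimensional ℝ E] [Nontrivial E] [MeasurableSpace E] [BorelSpace E]
    [NormedAddCommGroup F] {μ : Measure E} [μ.IsAddHaarMeasure] {f : E → F}
    (hf : Integrable f μ) :
    Integrable (fun p => f (p.2.1 • p.1.1))
      (μ.toSphere.prod (Measure.volumeIoiPow (Module.finrank ℝ E - 1))) := by
  rw [← μ.measurePreserving_homeomorphUnitSphereProd.integrable_comp_emb
    (Homeomorph.measurableEmbedding _)]
  rw [← restrict_compl_singleton (μ := μ) (0 : E)] at hf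
  refine ((integrableOn_iff_comap_subtypeVal (measurableSet_singleton _).compl).1 hf).congr
    (.of_forall fun x => congrArg f ?_)
  simp [smul_smul, mul_inv_cancel₀ (norm_ne_zero_iff.2 x.2)]

theorem integral_eq_integral_uniformSphere {d : ℕ} [NeZero d] {F : Type*} [NormedAddCommGroup F]
    [NormedSpace ℝ F] {f : EuclideanSpace ℂ (Fin d) → F} (hf : Integrable f) :
    ∫ x, f x = ∫ ψ, (∫ x : EuclideanSpace ℂ (Fin d), f (‖x‖ • ψ.1)) ∂(uniformSphere d) := by
  set τ := (volume : Measure (EuclideanSpace ℂ (Fin d))).toSphere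
  have hτ : τ.real Set.univ ≠ 0 :=
    (measureReal_ne_zero_iff (measure_ne_top τ _)).2
      (Measure.measure_univ_ne_zero.2 (Measure.toSphere_ne_zero _))
  have hradial (ψ : CSphere d) : ∫ x : EuclideanSpace ℂ (Fin d), f (‖x‖ • ψ.1) =
      τ.real Set.univ • ∫ r, f (r.1 • ψ.1) ∂(Measure.volumeIoiPow
        (Module.finrank ℝ (EuclideanSpace ℂ (Fin d)) - 1)) := by
    rw [integral_eq_integral_toSphere_prod, ← integral_fun_snd]
    refine integral_congr_ae (.of_forall fun p => congrArg f ?_)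
    simp [norm_smul, abs_of_pos (show 0 < p.2.1 from p.2.2)]
  simp_rw [hradial]
  rw [integral_smul, uniformSphere, integral_smul_measure, smul_smul, ENNReal.toReal_inv,
    ← measureReal_def, mul_inv_cancel₀ hτ, one_smul, integral_eq_integral_toSphere_prod,
    integral_prod _ (integrable_toSphere_prod hf)]

theorem exists_integral_cexp_neg_sum_mul_norm_sq (d : ℕ) :
    ∃ K : ℝ, 0 < K ∧ ∀ b : Fin d → ℂ, (∀ i, 0 < (b i).re) →
      ∫ x : EuclideanSpace ℂ (Fin d), Complex.exp (-∑ i, b i * (‖x i‖ : ℂ) ^ 2)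
        = K * ∏ i, (b i)⁻¹ := by
  let e : (Fin d → ℂ) ≃L[ℝ] EuclideanSpace ℂ (Fin d) :=
    (PiLp.continuousLinearEquiv 2 ℝ (fun _ : Fin d => ℂ)).symm
  have : ((volume : Measure (Fin d → ℂ)).map e).IsAddHaarMeasure := e.isAddHaarMeasure_map _
  refine ⟨Measure.addHaarScalarFactor volume (volume.map e) * Real.pi ^ d,
    mul_pos (NNReal.coe_pos.2 (Measure.addHaarScalarFactor_pos_of_isAddHaarMeasure _ _))
      (by positivity), fun b hb => ?_⟩
  have hexp (x : Fin d → ℂ) : Complex.exp (-∑ i, b i * (‖e x i‖ : ℂ) ^ 2)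
      = ∏ i, Complex.exp (-b i * (‖x i‖ : ℂ) ^ 2) := by
    rw [← Complex.exp_sum, ← Finset.sum_neg_distrib]
    simp only [neg_mul]
    rfl
  have hcoord (i) : ∫ y : ℂ, Complex.exp (-b i * (‖y‖ : ℂ) ^ 2) = Real.pi * (b i)⁻¹ := by
    rw [GaussianFourier.integral_cexp_neg_mul_sq_norm (hb i)]
    simp [Complex.finrank_real_complex, div_eq_mul_inv]
  have hvol := Measure.isAddLeftInvariant_eq_smul
    (volume : Measure (EuclideanSpace ℂ (Fin d))) (volume.map e)
  set c := Measure.addHaarScalarFactor (volume : Measure (EuclideanSpace ℂ (Fin d)))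
    (volume.map e)
  have he : MeasurableEmbedding e := e.toHomeomorph.measurableEmbedding
  rw [hvol, integral_smul_nnreal_measure, he.integral_map]
  simp_rw [hexp]
  rw [volume_pi,
    integral_fintype_prod_eq_prod fun i (y : ℂ) => Complex.exp (-b i * (‖y‖ : ℂ) ^ 2)]
  simp_rw [hcoord, Finset.prod_mul_distrib]
  simp [mul_assoc, NNReal.smul_def]

theorem ofReal_re_trace_mul {ι : Type*} [Fintype ι] {A B : Matrix ι ι ℂ} (hA : A.IsHermitian)
    (hB : B.IsHermitian) : ((A * B).trace.re : ℂ) = (A * B).trace := by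
  refine Complex.conj_eq_iff_re.1 ?_
  rw [← RCLike.star_def, ← Matrix.trace_conjTranspose, Matrix.conjTranspose_mul, hA.eq, hB.eq,
    Matrix.trace_mul_comm]

/-- The expectation value `⟨x|Δ|x⟩` of a Hermitian matrix `Δ`, as a real number. -/
def expect {d : ℕ} (Δ : Matrix (Fin d) (Fin d) ℂ) (x : EuclideanSpace ℂ (Fin d)) : ℝ :=
  (Δ * rankOne x).trace.re

section Expect

variable {d : ℕ} {Δ : Matrix (Fin d) (Fin d) ℂ}

theorem trace_mul_rankOne (Δ : Matrix (Fin d) (Fin d) ℂ) (x : EuclideanSpace ℂ (Fin d)) :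
    (Δ * rankOne x).trace = star x.ofLp ⬝ᵥ (Δ *ᵥ x.ofLp) := by
  rw [rankOne, Matrix.mul_vecMulVec, Matrix.trace_vecMulVec, dotProduct_comm]

theorem trace_mul_rankOne_eq_expect (hΔ : Δ.IsHermitian) (x : EuclideanSpace ℂ (Fin d)) :
    (Δ * rankOne x).trace = expect Δ x :=
  (ofReal_re_trace_mul hΔ (Matrix.posSemidef_vecMulVec_self_star _).isHermitian).symm

theorem expect_smul (Δ : Matrix (Fin d) (Fin d) ℂ) (r : ℝ) (x : EuclideanSpace ℂ (Fin d)) :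
    expect Δ (r • x) = r ^ 2 * expect Δ x := by
  simp only [expect, trace_mul_rankOne, WithLp.ofLp_smul, Matrix.mulVec_smul, dotProduct_smul,
    star_smul, smul_dotProduct, Complex.smul_re, star_trivial, smul_eq_mul]
  ring

theorem continuous_expect (Δ : Matrix (Fin d) (Fin d) ℂ) : Continuous (expect Δ) := by
  unfold expect
  simp only [trace_mul_rankOne]
  fun_prop

theorem expect_eq_sum_eigenvalues (hΔ : Δ.IsHermitian) (x : EuclideanSpace ℂ (Fin d)) :
    expect Δ x = ∑ i, hΔ.eigenvalues i * ‖hΔ.eigenvectorBasis.repr x i‖ ^ 2 := by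
  have hx : Δ *ᵥ x.ofLp = ∑ i, hΔ.eigenvectorBasis.repr x i •
      (hΔ.eigenvalues i • (hΔ.eigenvectorBasis i).ofLp) := by
    conv_lhs => rw [← hΔ.eigenvectorBasis.sum_repr x]
    simp only [WithLp.ofLp_sum, Matrix.mulVec_sum, WithLp.ofLp_smul, Matrix.mulVec_smul,
      hΔ.mulVec_eigenvectorBasis]
  have hcoord (i) : star x.ofLp ⬝ᵥ (hΔ.eigenvectorBasis i).ofLp
      = star (hΔ.eigenvectorBasis.repr x i) := by
    rw [hΔ.eigenvectorBasis.repr_apply_apply, EuclideanSpace.inner_eq_star_dotProduct,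
      Matrix.star_dotProduct, dotProduct_comm]
  have hnorm (w : ℂ) : w * star w = ((‖w‖ ^ 2 : ℝ) : ℂ) := by
    rw [RCLike.star_def, Complex.mul_conj, Complex.normSq_eq_norm_sq]
  rw [expect, trace_mul_rankOne, hx, dotProduct_sum, Complex.re_sum]
  refine Finset.sum_congr rfl fun i _ => ?_
  rw [dotProduct_smul, dotProduct_smul, hcoord, Complex.real_smul, smul_eq_mul, mul_left_comm,
    hnorm, ← Complex.ofReal_mul, Complex.ofReal_re]

theorem norm_sq_eq_sum_eigenvectorBasis (hΔ : Δ.IsHermitian) (x : EuclideanSpace ℂ (Fin d)) :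
    ‖x‖ ^ 2 = ∑ i, ‖hΔ.eigenvectorBasis.repr x i‖ ^ 2 := by
  rw [← hΔ.eigenvectorBasis.repr.norm_map, EuclideanSpace.norm_sq_eq]

theorem re_mul_expect_lt_one (hΔ : Δ.IsHermitian) {z : ℂ}
    (hz : ∀ i, (z * hΔ.eigenvalues i).re < 1) (ψ : CSphere d) : (z * expect Δ ψ.1).re < 1 := by
  have hψ : ∑ i, ‖hΔ.eigenvectorBasis.repr ψ.1 i‖ ^ 2 = 1 := by
    rw [← norm_sq_eq_sum_eigenvectorBasis, norm_eq_of_mem_sphere, one_pow]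
  obtain ⟨i, -, hi⟩ : ∃ i ∈ Finset.univ, ‖hΔ.eigenvectorBasis.repr ψ.1 i‖ ^ 2 ≠ 0 :=
    Finset.exists_ne_zero_of_sum_ne_zero (hψ ▸ one_ne_zero)
  simp only [Complex.re_mul_ofReal] at hz ⊢
  rw [expect_eq_sum_eigenvalues hΔ, Finset.mul_sum]
  refine (Finset.sum_lt_sum (fun j _ => ?_) ⟨i, Finset.mem_univ i, ?_⟩).trans_eq hψ
  · nlinarith [hz j, sq_nonneg ‖hΔ.eigenvectorBasis.repr ψ.1 j‖]
  · nlinarith [hz i, (sq_nonneg ‖hΔ.eigenvectorBasis.repr ψ.1 i‖).lt_of_ne' hi]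

theorem integral_gaussian_cexp_expect {K : ℝ}
    (hK : ∀ b : Fin d → ℂ, (∀ i, 0 < (b i).re) →
      ∫ x : EuclideanSpace ℂ (Fin d), Complex.exp (-∑ i, b i * (‖x i‖ : ℂ) ^ 2)
        = K * ∏ i, (b i)⁻¹)
    (hΔ : Δ.IsHermitian) {z : ℂ} (hz : ∀ i, (z * hΔ.eigenvalues i).re < 1) :
    ∫ x : EuclideanSpace ℂ (Fin d), Complex.exp (-‖x‖ ^ 2 + z * expect Δ x)
      = K * ∏ i, (1 - z * hΔ.eigenvalues i)⁻¹ := by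
  let L : EuclideanSpace ℂ (Fin d) ≃ₗᵢ[ℝ] EuclideanSpace ℂ (Fin d) :=
    { hΔ.eigenvectorBasis.repr.toLinearEquiv.restrictScalars ℝ with
      norm_map' := hΔ.eigenvectorBasis.repr.norm_map }
  rw [← hK (fun i => 1 - z * hΔ.eigenvalues i) fun i => by simpa using hz i]
  conv_rhs => rw [← L.measurePreserving.integral_comp L.toHomeomorph.measurableEmbedding]
  refine integral_congr_ae (.of_forall fun x => congrArg Complex.exp ?_)
  rw [← Complex.ofReal_pow, norm_sq_eq_sum_eigenvectorBasis hΔ, expect_eq_sum_eigenvalues hΔ]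
  change _ = -∑ i, (1 - z * hΔ.eigenvalues i) * (‖hΔ.eigenvectorBasis.repr x i‖ : ℂ) ^ 2
  push_cast
  rw [Finset.mul_sum, ← Finset.sum_neg_distrib, ← Finset.sum_neg_distrib, ← Finset.sum_add_distrib]
  exact Finset.sum_congr rfl fun i _ => by ring

theorem integral_inv_one_sub_mul_expect_pow [NeZero d] (hΔ : Δ.IsHermitian) {z : ℂ}
    (hz : ∀ i, (z * hΔ.eigenvalues i).re < 1) :
    ∫ ψ, (1 - z * expect Δ ψ.1)⁻¹ ^ d ∂(uniformSphere d) = ∏ i, (1 - z * hΔ.eigenvalues i)⁻¹ := by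
  -- Integrate `exp (-‖x‖² + z ⟨x|Δ|x⟩)` over `ℂ^d`, in an eigenbasis and in polar coordinates.
  obtain ⟨K, hKpos, hK⟩ := exists_integral_cexp_neg_sum_mul_norm_sq d
  have hK0 : (K : ℂ) ≠ 0 := Complex.ofReal_ne_zero.2 hKpos.ne'
  have hGauss := integral_gaussian_cexp_expect hK hΔ hz
  have h_int : Integrable fun x => Complex.exp (-‖x‖ ^ 2 + z * expect Δ x) := by
    refine not_imp_comm.1 integral_undef ?_
    rw [hGauss]
    refine mul_ne_zero hK0 (Finset.prod_ne_zero_iff.2 fun i _ => inv_ne_zero fun h => ?_)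
    simpa [← sub_eq_zero.1 h] using hz i
  have hradial (ψ : CSphere d) : ∫ x : EuclideanSpace ℂ (Fin d),
      Complex.exp (-‖‖x‖ • ψ.1‖ ^ 2 + z * expect Δ (‖x‖ • ψ.1))
        = K * (1 - z * expect Δ ψ.1)⁻¹ ^ d := by
    have h := hK (fun _ => 1 - z * expect Δ ψ.1) fun _ => by
      simpa using re_mul_expect_lt_one hΔ hz ψ
    rw [Finset.prod_const, Finset.card_univ, Fintype.card_fin] at h
    rw [← h]
    refine integral_congr_ae (.of_forall fun x => congrArg Complex.exp ?_)
    have hx : (‖x‖ : ℂ) ^ 2 = ∑ i, (‖x i‖ : ℂ) ^ 2 := by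
      exact_mod_cast EuclideanSpace.norm_sq_eq x
    rw [← Finset.mul_sum, ← hx, expect_smul, norm_smul, norm_norm, norm_eq_of_mem_sphere]
    push_cast
    ring
  rw [integral_eq_integral_uniformSphere h_int] at hGauss
  simp_rw [hradial] at hGauss
  rw [integral_const_mul] at hGauss
  exact mul_left_cancel₀ hK0 hGauss

end Expect

/-! ### The distinguishability norm of the uniform POVM -/

/-- The density `Δ ↦ tr (Δ · d |ψ⟩⟨ψ|) = d ⟨ψ|Δ|ψ⟩` at `ψ` of the outcome distribution of the
uniform POVM, as a real linear functional of `Δ`. -/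
def uniformDensity {d : ℕ} (ψ : CSphere d) : Matrix (Fin d) (Fin d) ℂ →ₗ[ℝ] ℝ where
  toFun Δ := d * expect Δ ψ.1
  map_add' A B := by simp [expect, Matrix.add_mul, mul_add]
  map_smul' r A := by
    rw [expect, Matrix.smul_mul, Matrix.trace_smul, Complex.smul_re, smul_eq_mul, mul_left_comm,
      expect]
    rfl

theorem uniformDensity_apply {d : ℕ} (ψ : CSphere d) (Δ : Matrix (Fin d) (Fin d) ℂ) :
    uniformDensity ψ Δ = d * expect Δ ψ.1 := rfl

theorem continuous_uniformDensity {d : ℕ} (Δ : Matrix (Fin d) (Fin d) ℂ) :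
    Continuous fun ψ : CSphere d => uniformDensity ψ Δ :=
  continuous_const.mul ((continuous_expect Δ).comp continuous_subtype_val)

theorem integrable_uniformSphere_of_continuous {d : ℕ} {E : Type*} [NormedAddCommGroup E]
    {f : CSphere d → E} (hf : Continuous f) : Integrable f (uniformSphere d) := by
  rw [← integrableOn_univ]
  exact hf.continuousOn.integrableOn_compact isCompact_univ

theorem integrable_uniformDensity {d : ℕ} (Δ : Matrix (Fin d) (Fin d) ℂ) :
    Integrable (fun ψ => uniformDensity ψ Δ) (uniformSphere d) :=
  integrable_uniformSphere_of_continuous (continuous_uniformDensity Δ)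

/-- The distinguishability norm of the uniform POVM, `Δ ↦ d ∫ |⟨ψ|Δ|ψ⟩| dσ(ψ)`, as a seminorm on
all matrices (it vanishes on anti-Hermitian ones). -/
def uniformNorm (d : ℕ) : Seminorm ℝ (Matrix (Fin d) (Fin d) ℂ) :=
  Seminorm.of (fun Δ => ∫ ψ, |uniformDensity ψ Δ| ∂(uniformSphere d))
    (fun A B => by
      rw [← integral_add (integrable_uniformDensity A).abs (integrable_uniformDensity B).abs]
      refine integral_mono (integrable_uniformDensity _).abs
        ((integrable_uniformDensity A).abs.add (integrable_uniformDensity B).abs) fun ψ => ?_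
      simpa only [map_add] using abs_add_le (uniformDensity ψ A) (uniformDensity ψ B))
    (fun r A => by
      simp only [map_smul, smul_eq_mul, abs_mul, integral_const_mul, Real.norm_eq_abs])

theorem uniformNorm_apply {d : ℕ} (Δ : Matrix (Fin d) (Fin d) ℂ) :
    uniformNorm d Δ = ∫ ψ, |uniformDensity ψ Δ| ∂(uniformSphere d) := rfl

theorem integral_uniformDensity {d : ℕ} (Δ : Matrix (Fin d) (Fin d) ℂ) :
    ∫ ψ, uniformDensity ψ Δ ∂(uniformSphere d) = Δ.trace.re := by
  have hsum (ψ : CSphere d) :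
      uniformDensity ψ Δ = (∑ a, ∑ b, Δ a b * ((d : ℂ) • rankOne ψ.1) b a).re := by
    change d * (Δ * rankOne ψ.1).trace.re = (Δ * ((d : ℂ) • rankOne ψ.1)).trace.re
    rw [Matrix.mul_smul, Matrix.trace_smul, smul_eq_mul, ← Complex.ofReal_natCast,
      Complex.re_ofReal_mul]
  have h_int (a b) : Integrable (fun ψ : CSphere d => Δ a b * ((d : ℂ) • rankOne ψ.1) b a)
      (uniformSphere d) := ((integrable_rankOne b a).const_mul (d : ℂ)).const_mul _
  have h_int' (a) := integrable_finsetSum Finset.univ fun b _ => h_int a b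
  simp_rw [hsum, ← RCLike.re_eq_complex_re]
  rw [integral_re (integrable_finsetSum _ fun a _ => h_int' a), integral_finsetSum _ fun a _ =>
    h_int' a]
  simp_rw [fun a => integral_finsetSum Finset.univ fun b _ => h_int a b, integral_const_mul,
    integral_rankOne, Matrix.one_apply, mul_ite, mul_one, mul_zero, Finset.sum_ite_eq',
    Finset.mem_univ, if_true]
  rfl

theorem abs_re_trace_le_uniformNorm {d : ℕ} (Δ : Matrix (Fin d) (Fin d) ℂ) :
    |Δ.trace.re| ≤ uniformNorm d Δ := by
  rw [← integral_uniformDensity]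
  exact abs_integral_le_integral_abs

theorem norm_one_sub_pow_le {R : Type*} [NormedRing R] [NormOneClass R] {w : R} (hw : ‖w‖ ≤ 1)
    (n : ℕ) : ‖1 - w ^ n‖ ≤ n * ‖1 - w‖ := by
  rw [← mul_neg_geom_sum]
  refine (norm_mul_le _ _).trans ?_
  rw [mul_comm]
  gcongr
  refine (norm_sum_le _ _).trans ?_
  simpa using Finset.sum_le_sum fun i (_ : i ∈ Finset.range n) =>
    (norm_pow_le w i).trans (pow_le_one₀ (norm_nonneg w) hw)

theorem one_sub_re_inv_one_sub_I_mul_pow_le (u : ℝ) (n : ℕ) :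
    1 - ((1 - Complex.I * u)⁻¹ ^ n).re ≤ n * |u| := by
  set v : ℂ := 1 - Complex.I * u
  have hv : 1 ≤ ‖v‖ := by simpa [v] using Complex.abs_re_le_norm v
  have hv0 : v ≠ 0 := norm_pos_iff.1 (by linarith)
  have hdiff : ‖1 - v⁻¹‖ ≤ |u| := by
    rw [show 1 - v⁻¹ = (v - 1) * v⁻¹ by field_simp, norm_mul, norm_inv]
    calc ‖v - 1‖ * ‖v‖⁻¹ ≤ ‖v - 1‖ * 1 := by gcongr; exact inv_le_one_of_one_le₀ hv
      _ = |u| := by simp [v]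
  calc 1 - (v⁻¹ ^ n).re = (1 - v⁻¹ ^ n).re := by simp
    _ ≤ ‖1 - v⁻¹ ^ n‖ := Complex.re_le_norm _
    _ ≤ n * ‖1 - v⁻¹‖ :=
      norm_one_sub_pow_le (by rw [norm_inv]; exact inv_le_one_of_one_le₀ hv) n
    _ ≤ n * |u| := by gcongr

theorem inv_one_sub_le_exp {y : ℝ} (hy : |y| ≤ 1 / 2) : (1 - y)⁻¹ ≤ Real.exp (y + 2 * y ^ 2) := by
  obtain ⟨-, hy'⟩ := abs_le.1 hy
  have h1 : 0 < 1 - y := by linarith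
  rw [inv_le_iff_one_le_mul₀ h1]
  nlinarith [mul_le_mul_of_nonneg_right (Real.add_one_le_exp (y + 2 * y ^ 2)) h1.le,
    mul_nonneg (sq_nonneg y) (by linarith : (0 : ℝ) ≤ 1 - 2 * y)]

section Frobenius

open scoped Matrix.Norms.Frobenius

theorem frobenius_norm_sq_eq_sum {m n : Type*} [Fintype m] [Fintype n] (A : Matrix m n ℂ) :
    ‖A‖ ^ 2 = ∑ a, ∑ b, ‖A a b‖ ^ 2 := by
  rw [Matrix.frobenius_norm_def, ← Real.rpow_natCast, ← Real.rpow_mul (by positivity)]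
  simp

theorem frobenius_norm_sq_eq_trace {m n : Type*} [Fintype m] [Fintype n] (A : Matrix m n ℂ) :
    ‖A‖ ^ 2 = (A * Aᴴ).trace.re := by
  simp only [frobenius_norm_sq_eq_sum, Matrix.trace, Complex.re_sum, Matrix.diag_apply,
    Matrix.mul_apply, Matrix.conjTranspose_apply, RCLike.star_def, Complex.mul_conj,
    Complex.normSq_eq_norm_sq, Complex.ofReal_re]

theorem frobenius_norm_sq_cfc {n : Type*} [Fintype n] [DecidableEq n] {A : Matrix n n ℂ}
    (hA : A.IsHermitian) (f : ℝ → ℝ) : ‖cfc f A‖ ^ 2 = ∑ i, f (hA.eigenvalues i) ^ 2 := by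
  have hs : (cfc f A)ᴴ = cfc f A := (cfc_predicate f A : IsSelfAdjoint _)
  rw [frobenius_norm_sq_eq_trace, hs, hA.cfc_eq, Matrix.IsHermitian.cfc, ← map_mul,
    Unitary.conjStarAlgAut_apply, Matrix.trace_mul_cycle,
    Unitary.coe_star_mul_self, one_mul, Matrix.diagonal_mul_diagonal, Matrix.trace_diagonal,
    Complex.re_sum]
  exact Finset.sum_congr rfl fun i _ => by simp [sq]

theorem frobenius_norm_sq_eq_sum_eigenvalues {n : Type*} [Fintype n] [DecidableEq n]
    {A : Matrix n n ℂ} (hA : A.IsHermitian) : ‖A‖ ^ 2 = ∑ i, hA.eigenvalues i ^ 2 := by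
  rw [← frobenius_norm_sq_cfc hA fun x => x, cfc_id' ℝ A]

theorem abs_apply_eigenvalue_le_frobenius_norm_cfc {n : Type*} [Fintype n] [DecidableEq n]
    {A : Matrix n n ℂ} (hA : A.IsHermitian) (f : ℝ → ℝ) (i : n) :
    |f (hA.eigenvalues i)| ≤ ‖cfc f A‖ := by
  refine abs_le_of_sq_le_sq ?_ (norm_nonneg _)
  rw [frobenius_norm_sq_cfc hA]
  exact Finset.single_le_sum (f := fun i => f (hA.eigenvalues i) ^ 2) (fun _ _ => sq_nonneg _)
    (Finset.mem_univ i)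

theorem abs_eigenvalue_le_frobenius_norm {n : Type*} [Fintype n] [DecidableEq n]
    {A : Matrix n n ℂ} (hA : A.IsHermitian) (i : n) : |hA.eigenvalues i| ≤ ‖A‖ := by
  simpa only [cfc_id' ℝ A] using abs_apply_eigenvalue_le_frobenius_norm_cfc hA (fun x => x) i

variable {d : ℕ} [NeZero d] {Δ : Matrix (Fin d) (Fin d) ℂ}

theorem one_sub_re_prod_le_uniformNorm (hΔ : Δ.IsHermitian) :
    1 - (∏ i, (1 - Complex.I * hΔ.eigenvalues i)⁻¹).re ≤ uniformNorm d Δ := by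
  have hz (i) : (Complex.I * hΔ.eigenvalues i).re < 1 := by simp
  have hne (ψ : CSphere d) : (1 : ℂ) - Complex.I * expect Δ ψ.1 ≠ 0 := fun h => by
    simpa using congrArg Complex.re h
  have hcont := continuous_expect Δ
  have h_int : Integrable (fun ψ : CSphere d => (1 - Complex.I * expect Δ ψ.1)⁻¹ ^ d)
      (uniformSphere d) :=
    integrable_uniformSphere_of_continuous (((by fun_prop : Continuous _).inv₀ hne).pow d)
  have hre := h_int.re
  calc 1 - (∏ i, (1 - Complex.I * hΔ.eigenvalues i)⁻¹).re
      = ∫ ψ : CSphere d, (1 - ((1 - Complex.I * expect Δ ψ.1)⁻¹ ^ d).re) ∂(uniformSphere d) := by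
        rw [← integral_inv_one_sub_mul_expect_pow hΔ hz, ← RCLike.re_eq_complex_re,
          ← integral_re h_int, integral_sub (integrable_const _) hre]
        simp
    _ ≤ uniformNorm d Δ := integral_mono ((integrable_const _).sub hre)
        (integrable_uniformDensity Δ).abs fun ψ => ?_
  simpa [uniformDensity_apply, abs_mul] using
    one_sub_re_inv_one_sub_I_mul_pow_le (expect Δ ψ.1) d

theorem one_add_sum_le_prod_one_add {ι : Type*} (s : Finset ι) {a : ι → ℝ}
    (ha : ∀ i ∈ s, 0 ≤ a i) : 1 + ∑ i ∈ s, a i ≤ ∏ i ∈ s, (1 + a i) := by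
  induction s using Finset.cons_induction with
  | empty => simp
  | cons i s hi ih =>
    rw [Finset.forall_mem_cons] at ha
    rw [Finset.sum_cons, Finset.prod_cons]
    nlinarith [ih ha.2, mul_nonneg ha.1 (Finset.sum_nonneg ha.2)]

theorem norm_prod_inv_one_sub_I_mul_sq_le {ι : Type*} [Fintype ι] (a : ι → ℝ) :
    ‖∏ i, (1 - Complex.I * a i)⁻¹‖ ^ 2 ≤ (1 + ∑ i, a i ^ 2)⁻¹ := by
  have hfactor (i) : ‖(1 - Complex.I * a i)⁻¹‖ ^ 2 = (1 + a i ^ 2)⁻¹ := by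
    rw [norm_inv, inv_pow, ← Complex.normSq_eq_norm_sq, Complex.normSq_apply]
    simp [sq]
  have hprod : 1 + ∑ i, a i ^ 2 ≤ ∏ i, (1 + a i ^ 2) :=
    one_add_sum_le_prod_one_add _ fun i _ => sq_nonneg (a i)
  rw [norm_prod, ← Finset.prod_pow, Finset.prod_congr rfl fun i _ => hfactor i,
    Finset.prod_inv_distrib]
  exact inv_anti₀ (by positivity) hprod

theorem one_fourth_le_uniformNorm (hΔ : Δ.IsHermitian) (h1 : ‖Δ‖ = 1) :
    1 / 4 ≤ uniformNorm d Δ := by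
  have hre := one_sub_re_prod_le_uniformNorm hΔ
  have hnorm := norm_prod_inv_one_sub_I_mul_sq_le hΔ.eigenvalues
  rw [← frobenius_norm_sq_eq_sum_eigenvalues hΔ, h1] at hnorm
  set w := ∏ i, (1 - Complex.I * hΔ.eigenvalues i)⁻¹
  nlinarith [Complex.re_le_norm w, norm_nonneg w]

theorem frobenius_norm_le_uniformNorm (hΔ : Δ.IsHermitian) : ‖Δ‖ ≤ 4 * uniformNorm d Δ := by
  rcases (norm_nonneg Δ).eq_or_lt with h0 | hpos
  · linarith [apply_nonneg (uniformNorm d) Δ]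
  · have h := one_fourth_le_uniformNorm (hΔ.smul (.all ‖Δ‖⁻¹))
      (by rw [norm_smul, norm_inv, norm_norm, inv_mul_cancel₀ hpos.ne'])
    rw [map_smul_eq_mul, norm_inv, norm_norm, inv_mul_eq_div, le_div_iff₀ hpos] at h
    linarith

theorem integral_exp_uniformDensity_le_prod (hΔ : Δ.IsHermitian)
    (hlt : ∀ i, hΔ.eigenvalues i < 1) :
    ∫ ψ, Real.exp (uniformDensity ψ Δ) ∂(uniformSphere d) ≤ ∏ i, (1 - hΔ.eigenvalues i)⁻¹ := by
  have hz (i) : (1 * hΔ.eigenvalues i : ℂ).re < 1 := by simpa using hlt i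
  have hlt (ψ : CSphere d) : 0 < 1 - expect Δ ψ.1 := by
    simpa using re_mul_expect_lt_one hΔ hz ψ
  have hcont := continuous_expect Δ
  have heq : ∫ ψ : CSphere d, (1 - expect Δ ψ.1)⁻¹ ^ d ∂(uniformSphere d)
      = ∏ i, (1 - hΔ.eigenvalues i)⁻¹ := by
    have h := integral_inv_one_sub_mul_expect_pow hΔ hz
    simp only [one_mul] at h
    exact_mod_cast h
  rw [← heq]
  refine integral_mono
    (integrable_uniformSphere_of_continuous (continuous_uniformDensity Δ).rexp)
    (integrable_uniformSphere_of_continuous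
      (((by fun_prop : Continuous _).inv₀ fun ψ => (hlt ψ).ne').pow d)) fun ψ => ?_
  have hexp : Real.exp (expect Δ ψ.1) ≤ (1 - expect Δ ψ.1)⁻¹ := by
    rw [← inv_inv (Real.exp _), ← Real.exp_neg]
    exact inv_anti₀ (hlt ψ) (Real.one_sub_le_exp_neg _)
  calc Real.exp (uniformDensity ψ Δ) = Real.exp (expect Δ ψ.1) ^ d := (Real.exp_nat_mul _ d)
    _ ≤ _ := pow_le_pow_left₀ (Real.exp_pos _).le hexp d

theorem integral_exp_uniformDensity_le (hΔ : Δ.IsHermitian) (h : ‖Δ‖ ≤ 1 / 2) :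
    ∫ ψ, Real.exp (uniformDensity ψ Δ) ∂(uniformSphere d)
      ≤ Real.exp (Δ.trace.re + 2 * ‖Δ‖ ^ 2) := by
  have hhalf (i) : |hΔ.eigenvalues i| ≤ 1 / 2 := (abs_eigenvalue_le_frobenius_norm hΔ i).trans h
  have hlt (i) : hΔ.eigenvalues i < 1 := by linarith [(abs_le.1 (hhalf i)).2]
  have htr : Δ.trace.re = ∑ i, hΔ.eigenvalues i := by
    rw [hΔ.trace_eq_sum_eigenvalues, Complex.re_sum]
    rfl
  calc ∫ ψ, Real.exp (uniformDensity ψ Δ) ∂(uniformSphere d)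
      ≤ ∏ i, (1 - hΔ.eigenvalues i)⁻¹ := integral_exp_uniformDensity_le_prod hΔ hlt
    _ ≤ ∏ i, Real.exp (hΔ.eigenvalues i + 2 * hΔ.eigenvalues i ^ 2) :=
        Finset.prod_le_prod (fun i _ => inv_nonneg.2 (sub_nonneg.2 (hlt i).le))
          fun i _ => inv_one_sub_le_exp (hhalf i)
    _ = _ := by
        rw [← Real.exp_sum, Finset.sum_add_distrib, ← Finset.mul_sum, htr,
          frobenius_norm_sq_eq_sum_eigenvalues hΔ]

theorem integral_exp_abs_uniformDensity_le (hΔ : Δ.IsHermitian) (h : ‖Δ‖ ≤ 1 / 2) :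
    ∫ ψ, Real.exp |uniformDensity ψ Δ| ∂(uniformSphere d)
      ≤ 2 * Real.exp (|Δ.trace.re| + 2 * ‖Δ‖ ^ 2) := by
  have h_int (A : Matrix (Fin d) (Fin d) ℂ) :
      Integrable (fun ψ => Real.exp (uniformDensity ψ A)) (uniformSphere d) :=
    integrable_uniformSphere_of_continuous (continuous_uniformDensity A).rexp
  have hpos := integral_exp_uniformDensity_le hΔ h
  have hneg := integral_exp_uniformDensity_le hΔ.neg (by rwa [norm_neg])
  rw [Matrix.trace_neg, Complex.neg_re, norm_neg] at hneg
  calc ∫ ψ, Real.exp |uniformDensity ψ Δ| ∂(uniformSphere d)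
      ≤ ∫ ψ, (Real.exp (uniformDensity ψ Δ) + Real.exp (uniformDensity ψ (-Δ)))
        ∂(uniformSphere d) := by
        refine integral_mono (integrable_uniformSphere_of_continuous
          (continuous_uniformDensity Δ).abs.rexp) ((h_int Δ).add (h_int (-Δ))) fun ψ => ?_
        simpa only [map_neg] using Real.exp_abs_le (uniformDensity ψ Δ)
    _ ≤ Real.exp (Δ.trace.re + 2 * ‖Δ‖ ^ 2) + Real.exp (-Δ.trace.re + 2 * ‖Δ‖ ^ 2) := by
        rw [integral_add (h_int Δ) (h_int (-Δ))]
        exact add_le_add hpos hneg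
    _ ≤ _ := by
        rw [two_mul (Real.exp _)]
        gcongr
        exacts [le_abs_self _, neg_le_abs _]

theorem integral_exp_abs_uniformDensity_le_four (hΔ : Δ.IsHermitian) (h : ‖Δ‖ ≤ 1 / 2)
    (htr : ‖Δ‖ + |Δ.trace.re| ≤ 5 / 8) :
    ∫ ψ, Real.exp |uniformDensity ψ Δ| ∂(uniformSphere d) ≤ 4 := by
  have hlog : |Δ.trace.re| + 2 * ‖Δ‖ ^ 2 ≤ Real.log 2 := by
    nlinarith [Real.log_two_gt_d9, norm_nonneg Δ]
  calc ∫ ψ, Real.exp |uniformDensity ψ Δ| ∂(uniformSphere d)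
      ≤ 2 * Real.exp (|Δ.trace.re| + 2 * ‖Δ‖ ^ 2) := integral_exp_abs_uniformDensity_le hΔ h
    _ ≤ 2 * Real.exp (Real.log 2) := by gcongr
    _ = 4 := by rw [Real.exp_log two_pos]; norm_num

theorem integral_exp_abs_uniformDensity_le_four_of_uniformNorm_le (hΔ : Δ.IsHermitian)
    (h : uniformNorm d Δ ≤ 1 / 8) :
    ∫ ψ, Real.exp |uniformDensity ψ Δ| ∂(uniformSphere d) ≤ 4 := by
  have hF := frobenius_norm_le_uniformNorm hΔ
  have htr := abs_re_trace_le_uniformNorm Δ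
  exact integral_exp_abs_uniformDensity_le_four hΔ (by linarith) (by linarith)

theorem uniformNorm_le_four (hΔ : Δ.IsHermitian) (h : ‖Δ‖ + |Δ.trace.re| ≤ 1 / 2) :
    uniformNorm d Δ ≤ 4 :=
  (integral_mono (integrable_uniformDensity Δ).abs
    (integrable_uniformSphere_of_continuous (continuous_uniformDensity Δ).abs.rexp)
    fun ψ => by linarith [Real.add_one_le_exp |uniformDensity ψ Δ|]).trans
    (integral_exp_abs_uniformDensity_le_four hΔ (by linarith [abs_nonneg Δ.trace.re])
      (by linarith))

theorem uniformNorm_le (hΔ : Δ.IsHermitian) : uniformNorm d Δ ≤ 8 * (‖Δ‖ + |Δ.trace.re|) := by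
  rcases (norm_nonneg Δ).eq_or_lt with h0 | hpos
  · simp [norm_eq_zero.1 h0.symm]
  · set s := ‖Δ‖ + |Δ.trace.re|
    have hs : 0 < s := by positivity
    have hr : 0 < (2 * s)⁻¹ := by positivity
    have h := uniformNorm_le_four (hΔ.smul (.all (2 * s)⁻¹)) (by
      rw [norm_smul, Matrix.trace_smul, Complex.smul_re, smul_eq_mul, abs_mul,
        Real.norm_of_nonneg hr.le, abs_of_pos hr, ← mul_add]
      change (2 * s)⁻¹ * s ≤ _
      field_simp
      rfl)
    rw [map_smul_eq_mul, Real.norm_of_nonneg hr.le, inv_mul_le_iff₀ (by positivity)] at h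
    linarith

end Frobenius

/-! ### A Bernstein inequality for independent sub-exponential variables -/

theorem exp_le_one_add_add_sq_mul_exp_abs (x : ℝ) :
    Real.exp x ≤ 1 + x + x ^ 2 * Real.exp |x| := by
  have h := Complex.norm_exp_sub_sum_le_norm_mul_exp x 2
  have hsum : Complex.exp x - ∑ m ∈ Finset.range 2, (x : ℂ) ^ m / m.factorial
      = (Real.exp x - (1 + x) : ℝ) := by
    simp [Finset.sum_range_succ]
  rw [hsum, Complex.norm_real, Complex.norm_real, Real.norm_eq_abs, Real.norm_eq_abs, sq_abs] at h
  linarith [(abs_le.1 h).2]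

theorem exp_mul_le_of_abs_le_half {s : ℝ} (hs : |s| ≤ 1 / 2) (z : ℝ) :
    Real.exp (s * z) ≤ 1 + s * z + 8 * s ^ 2 * Real.exp |z| := by
  have hsz : |s * z| ≤ |z| / 2 := by
    rw [abs_mul]
    nlinarith [abs_nonneg z]
  have hsq : z ^ 2 ≤ 8 * Real.exp (|z| / 2) := by
    nlinarith [Real.quadratic_le_exp_of_nonneg (by positivity : 0 ≤ |z| / 2), abs_nonneg z,
      sq_abs z]
  calc Real.exp (s * z) ≤ 1 + s * z + (s * z) ^ 2 * Real.exp |s * z| :=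
        exp_le_one_add_add_sq_mul_exp_abs _
    _ ≤ 1 + s * z + s ^ 2 * (8 * Real.exp (|z| / 2)) * Real.exp (|z| / 2) := by
        rw [mul_pow]
        gcongr
    _ = 1 + s * z + 8 * s ^ 2 * Real.exp |z| := by
        rw [← add_halves |z|, Real.exp_add, add_halves]
        ring

section Bernstein

variable {X : Type*} [MeasurableSpace X] {μ : Measure X} {Z : X → ℝ} {B : ℝ}

theorem integrable_exp_mul_of_integrable_exp_abs (hZ : AEStronglyMeasurable Z μ)
    (hexp : Integrable (fun x => Real.exp |Z x|) μ) {s : ℝ} (hs : |s| ≤ 1) :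
    Integrable (fun x => Real.exp (s * Z x)) μ := by
  refine hexp.mono' (Real.continuous_exp.comp_aestronglyMeasurable (hZ.const_mul s))
    (.of_forall fun x => ?_)
  rw [Real.norm_eq_abs, Real.abs_exp]
  refine Real.exp_le_exp.2 ((le_abs_self _).trans ?_)
  rw [abs_mul]
  exact mul_le_of_le_one_left (abs_nonneg _) hs

variable [IsProbabilityMeasure μ]

theorem integral_exp_mul_le (hZ : Integrable Z μ) (hexp : Integrable (fun x => Real.exp |Z x|) μ)
    (hB : ∫ x, Real.exp |Z x| ∂μ ≤ B) {s : ℝ} (hs : |s| ≤ 1 / 2) :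
    ∫ x, Real.exp (s * Z x) ∂μ ≤ Real.exp (s * ∫ x, Z x ∂μ + 8 * B * s ^ 2) := by
  have hlin : Integrable (fun x => 1 + s * Z x) μ := (integrable_const _).add (hZ.const_mul s)
  calc ∫ x, Real.exp (s * Z x) ∂μ
      ≤ ∫ x, (1 + s * Z x + 8 * s ^ 2 * Real.exp |Z x|) ∂μ :=
        integral_mono
          (integrable_exp_mul_of_integrable_exp_abs hZ.aestronglyMeasurable hexp (by linarith))
          (hlin.add (hexp.const_mul _)) fun x => exp_mul_le_of_abs_le_half hs _
    _ = 1 + s * ∫ x, Z x ∂μ + 8 * s ^ 2 * ∫ x, Real.exp |Z x| ∂μ := by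
        rw [integral_add hlin (hexp.const_mul _), integral_add (integrable_const _)
          (hZ.const_mul s), integral_const_mul, integral_const_mul]
        simp
    _ ≤ s * ∫ x, Z x ∂μ + 8 * B * s ^ 2 + 1 := by
        nlinarith [mul_le_mul_of_nonneg_left hB (sq_nonneg s)]
    _ ≤ _ := Real.add_one_le_exp _

theorem measure_pi_sum_ge_le (hZ : Integrable Z μ) (hexp : Integrable (fun x => Real.exp |Z x|) μ)
    (hB0 : 0 < B) (hB : ∫ x, Real.exp |Z x| ∂μ ≤ B) {δ : ℝ} (hδ0 : 0 ≤ δ) (hδB : δ ≤ 8 * B)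
    (n : ℕ) :
    (Measure.pi fun _ : Fin n => μ).real {ω | n * (∫ x, Z x ∂μ + δ) ≤ ∑ j, Z (ω j)}
      ≤ Real.exp (-(n * δ ^ 2 / (32 * B))) := by
  -- `s = δ / (16 B)` minimizes the Chernoff exponent `-s δ + 8 B s ^ 2`
  set s := δ / (16 * B)
  have hs0 : 0 ≤ s := by positivity
  have hs1 : |s| ≤ 1 / 2 := by
    rw [abs_of_nonneg hs0, div_le_iff₀ (by positivity)]
    linarith
  have hprod : (fun ω : Fin n → X => Real.exp (s * ∑ j, Z (ω j)))
      = fun ω => ∏ j, Real.exp (s * Z (ω j)) := by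
    simp_rw [Finset.mul_sum, Real.exp_sum]
  have h_int : Integrable (fun ω : Fin n → X => Real.exp (s * ∑ j, Z (ω j)))
      (Measure.pi fun _ : Fin n => μ) := by
    rw [hprod]
    exact .fintype_prod fun _ =>
      integrable_exp_mul_of_integrable_exp_abs hZ.aestronglyMeasurable hexp (by linarith)
  refine (measure_ge_le_exp_mul_mgf _ hs0 h_int).trans ?_
  rw [mgf, hprod, integral_fintype_prod_eq_pow fun x => Real.exp (s * Z x), Fintype.card_fin]
  calc Real.exp (-s * (n * (∫ x, Z x ∂μ + δ))) * (∫ x, Real.exp (s * Z x) ∂μ) ^ n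
      ≤ Real.exp (-s * (n * (∫ x, Z x ∂μ + δ)))
        * Real.exp (s * ∫ x, Z x ∂μ + 8 * B * s ^ 2) ^ n := by
        gcongr
        exact integral_exp_mul_le hZ hexp hB hs1
    _ = Real.exp (-(n * δ ^ 2 / (32 * B))) := by
        rw [← Real.exp_nat_mul, ← Real.exp_add]
        congr 1
        simp only [s]
        field_simp
        ring

theorem measure_pi_abs_average_sub_integral_ge_le (hZ : Integrable Z μ)
    (hexp : Integrable (fun x => Real.exp |Z x|) μ) (hB0 : 0 < B)
    (hB : ∫ x, Real.exp |Z x| ∂μ ≤ B) {δ : ℝ} (hδ0 : 0 ≤ δ) (hδB : δ ≤ 8 * B) {n : ℕ}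
    (hn : 0 < n) :
    (Measure.pi fun _ : Fin n => μ).real {ω | δ ≤ |(n : ℝ)⁻¹ * ∑ j, Z (ω j) - ∫ x, Z x ∂μ|}
      ≤ 2 * Real.exp (-(n * δ ^ 2 / (32 * B))) := by
  have hpos := measure_pi_sum_ge_le hZ hexp hB0 hB hδ0 hδB n
  have hneg := measure_pi_sum_ge_le (Z := fun x => -Z x) hZ.neg (by simpa using hexp) hB0
    (by simpa using hB) hδ0 hδB n
  have hsub : {ω : Fin n → X | δ ≤ |(n : ℝ)⁻¹ * ∑ j, Z (ω j) - ∫ x, Z x ∂μ|}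
      ⊆ {ω | n * (∫ x, Z x ∂μ + δ) ≤ ∑ j, Z (ω j)}
        ∪ {ω | n * (∫ x, -Z x ∂μ + δ) ≤ ∑ j, -Z (ω j)} := by
    intro ω hω
    have hn' : (0 : ℝ) < n := Nat.cast_pos.2 hn
    simp only [Set.mem_union, Set.mem_ofPred_eq, integral_neg, Finset.sum_neg_distrib,
      ← le_inv_mul_iff₀ hn', mul_neg] at hω ⊢
    rcases le_abs.1 hω with h | h
    · left; linarith
    · right; linarith
  calc _ ≤ _ := measureReal_mono hsub
    _ ≤ _ := measureReal_union_le _ _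
    _ ≤ _ := by linarith

end Bernstein

/-! ### Nets on the unit sphere -/

section Net

variable {E : Type*} [NormedAddCommGroup E] [NormedSpace ℝ E] [FiniteDimensional ℝ E]

open scoped NNReal

theorem card_le_of_isSeparated {η : ℝ≥0} (hη : 0 < η) {s : Finset E}
    (hs : (s : Set E) ⊆ closedBall 0 1) (hsep : IsSeparated η (s : Set E)) :
    (s.card : ℝ) ≤ (1 + 2 / η) ^ Module.finrank ℝ E := by
  borelize E
  let μ : Measure E := Measure.addHaar
  have hη2 : (0 : ℝ) < η / 2 := by positivity
  have hdisj : (s : Set E).PairwiseDisjoint fun c => ball c (η / 2 : ℝ) :=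
    fun c hc c' hc' hne => ball_disjoint_ball (by
      have h : (η : ENNReal) < edist c c' := hsep hc hc' hne
      rw [edist_nndist, ENNReal.coe_lt_coe, ← NNReal.coe_lt_coe, coe_nndist] at h
      linarith)
  have hsub : ⋃ c ∈ s, ball c (η / 2 : ℝ) ⊆ ball 0 (1 + η / 2) :=
    Set.iUnion₂_subset fun c hc => ball_subset_ball' (by
      linarith [mem_closedBall.1 (hs hc)])
  have hvolume (x : E) {r : ℝ} (hr : 0 < r) :
      μ.real (ball x r) = r ^ Module.finrank ℝ E * μ.real (ball 0 1) := by
    rw [measureReal_def, μ.addHaar_ball_of_pos x hr, ENNReal.toReal_mul,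
      ENNReal.toReal_ofReal (by positivity), measureReal_def]
  have hcard : s.card * ((η / 2 : ℝ) ^ Module.finrank ℝ E * μ.real (ball 0 1))
      ≤ (1 + η / 2) ^ Module.finrank ℝ E * μ.real (ball 0 1) := by
    calc s.card * ((η / 2 : ℝ) ^ Module.finrank ℝ E * μ.real (ball 0 1))
        = μ.real (⋃ c ∈ s, ball c (η / 2 : ℝ)) := by
          rw [measureReal_biUnion_finset hdisj (fun _ _ => measurableSet_ball)
            fun _ _ => measure_ball_lt_top.ne]
          simp [hvolume _ hη2]
      _ ≤ μ.real (ball 0 (1 + η / 2)) := measureReal_mono hsub measure_ball_lt_top.ne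
      _ = _ := hvolume 0 (by positivity)
  have hball : 0 < μ.real (ball 0 1) :=
    ENNReal.toReal_pos (measure_ball_pos _ _ one_pos).ne' measure_ball_lt_top.ne
  rw [← mul_assoc, mul_le_mul_iff_left₀ hball, ← le_div_iff₀ (by positivity), ← div_pow] at hcard
  refine hcard.trans_eq ?_
  congr 1
  field_simp
  ring

theorem packingNumber_le_of_forall_finset {X : Type*} [PseudoEMetricSpace X] {η : ℝ≥0} {A : Set X}
    {N : ℕ} (h : ∀ s : Finset X, (s : Set X) ⊆ A → IsSeparated η (s : Set X) → s.card ≤ N) :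
    packingNumber η A ≤ N := by
  refine iSup_le fun C => iSup₂_le fun hC hsep => ?_
  by_contra! hlt
  obtain ⟨t, htC, ht⟩ := Set.exists_subset_encard_eq (Order.add_one_le_of_lt hlt)
  lift t to Finset X using Set.finite_of_encard_eq_coe ht
  rw [Set.encard_coe_eq_coe_finsetCard] at ht
  have hle := h t (htC.trans hC) (hsep.subset htC)
  rw [← ENat.natCast_le_natCast, ht] at hle
  exact absurd hle (by norm_cast; lia)

theorem exists_sphere_net (E : Type*) [NormedAddCommGroup E] [NormedSpace ℝ E]
    [FiniteDimensional ℝ E] {η : ℝ} (hη : 0 < η) :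
    ∃ s : Finset E, s.card ≤ (1 + 2 / η) ^ Module.finrank ℝ E ∧ (∀ c ∈ s, ‖c‖ = 1) ∧
      ∀ x : E, ‖x‖ = 1 → ∃ c ∈ s, ‖x - c‖ ≤ η := by
  lift η to ℝ≥0 using hη.le
  have hcard (s : Finset E) (hs : (s : Set E) ⊆ sphere 0 1) (hsep : IsSeparated η (s : Set E)) :=
    card_le_of_isSeparated hη (hs.trans sphere_subset_closedBall) hsep
  have hfin : packingNumber η (sphere (0 : E) 1) ≠ ⊤ :=
    ne_top_of_le_ne_top (ENat.natCast_ne_top _)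
      (packingNumber_le_of_forall_finset fun s hs hsep => Nat.le_floor (hcard s hs hsep))
  set t := maximalSeparatedSet η (sphere (0 : E) 1)
  have ht : t.Finite := Set.encard_ne_top_iff.1 ((encard_maximalSeparatedSet hfin).symm ▸ hfin)
  have hsub : t ⊆ sphere 0 1 := maximalSeparatedSet_subset
  have hcover := isCover_iff_subset_iUnion_closedBall.1 (isCover_maximalSeparatedSet hfin)
  refine ⟨ht.toFinset, hcard _ (by simpa using hsub) (by
    simpa using isSeparated_maximalSeparatedSet), fun c hc => ?_, fun x hx => ?_⟩
  · simpa using hsub (ht.mem_toFinset.1 hc)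
  · obtain ⟨c, hc, hxc⟩ := Set.mem_iUnion₂.1 (hcover (by simpa using hx : x ∈ sphere (0 : E) 1))
    exact ⟨c, ht.mem_toFinset.2 hc, by rwa [← dist_eq_norm]⟩

theorem continuous_seminorm (q : Seminorm ℝ E) : Continuous q :=
  q.convexOn.locallyLipschitz.continuous

theorem seminorm_le_of_net {q : Seminorm ℝ E} {s : Set E} {η C : ℝ} (hη : η < 1)
    (hs : ∀ x : E, ‖x‖ = 1 → ∃ c ∈ s, ‖x - c‖ ≤ η) (hq : ∀ c ∈ s, q c ≤ C) (x : E) :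
    q x ≤ C / (1 - η) * ‖x‖ := by
  rcases eq_or_ne x 0 with rfl | hx
  · simp
  have hunit {y : E} (hy : y ≠ 0) : ‖‖y‖⁻¹ • y‖ = 1 := by
    rw [norm_smul, norm_inv, norm_norm, inv_mul_cancel₀ (norm_ne_zero_iff.2 hy)]
  -- the net controls `q` up to `q x₀ * η` at a point `x₀` of the sphere where `q` is maximal
  obtain ⟨x₀, hx₀, hmax⟩ := (isCompact_sphere (0 : E) 1).exists_isMaxOn
    ⟨_, mem_sphere_zero_iff_norm.2 (hunit hx)⟩ (continuous_seminorm q).continuousOn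
  have hle (y : E) : q y ≤ q x₀ * ‖y‖ := by
    rcases eq_or_ne y 0 with rfl | hy
    · simp
    have h : q (‖y‖⁻¹ • y) ≤ q x₀ := hmax (mem_sphere_zero_iff_norm.2 (hunit hy))
    rwa [map_smul_eq_mul, norm_inv, norm_norm, inv_mul_le_iff₀ (norm_pos_iff.2 hy), mul_comm] at h
  obtain ⟨c, hc, hxc⟩ := hs x₀ (mem_sphere_zero_iff_norm.1 hx₀)
  have hx₀C : q x₀ ≤ C / (1 - η) := by
    rw [le_div_iff₀ (by linarith)]
    have htri := map_add_le_add q c (x₀ - c)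
    rw [add_sub_cancel] at htri
    linarith [hq c hc, hle (x₀ - c), mul_le_mul_of_nonneg_left hxc (apply_nonneg q x₀)]
  exact (hle x).trans (mul_le_mul_of_nonneg_right hx₀C (norm_nonneg x))

theorem abs_seminorm_sub_norm_le_of_net {q : Seminorm ℝ E} {s : Set E} {η : ℝ} (hη : η ≤ 1 / 2)
    (hs : ∀ x : E, ‖x‖ = 1 → ∃ c ∈ s, ‖x - c‖ ≤ η) (hq : ∀ c ∈ s, |q c - 1| ≤ η) (x : E) :
    |q x - ‖x‖| ≤ 4 * η * ‖x‖ := by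
  rcases eq_or_ne x 0 with rfl | hx
  · simp
  have hx0 : 0 < ‖x‖ := norm_pos_iff.2 hx
  have hη0 : 0 ≤ η := by
    obtain ⟨c, hc, -⟩ := hs (‖x‖⁻¹ • x) (by rw [norm_smul, norm_inv, norm_norm,
      inv_mul_cancel₀ hx0.ne'])
    exact (abs_nonneg _).trans (hq c hc)
  have hupper (y : E) : q y ≤ (1 + 4 * η) * ‖y‖ := by
    refine (seminorm_le_of_net (C := 1 + η) (by linarith) hs
      (fun c hc => by linarith [(abs_le.1 (hq c hc)).2]) y).trans ?_
    gcongr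
    rw [div_le_iff₀ (by linarith)]
    nlinarith
  have hlower : 1 - 4 * η ≤ q (‖x‖⁻¹ • x) := by
    obtain ⟨c, hc, hxc⟩ := hs (‖x‖⁻¹ • x) (by rw [norm_smul, norm_inv, norm_norm,
      inv_mul_cancel₀ hx0.ne'])
    have htri := le_map_add_map_sub' q c (‖x‖⁻¹ • x)
    have hfar := hupper (‖x‖⁻¹ • x - c)
    nlinarith [(abs_le.1 (hq c hc)).1]
  rw [map_smul_eq_mul, norm_inv, norm_norm, le_inv_mul_iff₀ hx0] at hlower
  rw [abs_le]
  constructor <;> linarith [hupper x]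

end Net

theorem exists_net_of_definite_seminorm {E : Type*} [AddCommGroup E] [Module ℝ E]
    [FiniteDimensional ℝ E] (p : Seminorm ℝ E) (hp : ∀ x, p x = 0 → x = 0) {η : ℝ} (hη0 : 0 < η)
    (hη : η ≤ 1 / 2) :
    ∃ s : Finset E, s.card ≤ (1 + 2 / η) ^ Module.finrank ℝ E ∧ (∀ c ∈ s, p c = 1) ∧
      (∀ q : Seminorm ℝ E, (∀ c ∈ s, q c ≤ η) → ∀ x, q x ≤ 4 * η * p x) ∧
      ∀ q : Seminorm ℝ E, (∀ c ∈ s, |q c - 1| ≤ η) → ∀ x, |q x - p x| ≤ 4 * η * p x := by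
  let : Norm E := ⟨p⟩
  have hcore : NormedSpace.Core ℝ E :=
    { norm_nonneg := apply_nonneg p
      norm_smul := map_smul_eq_mul p
      norm_triangle := map_add_le_add p
      norm_eq_zero_iff := fun x => ⟨hp x, fun h => h ▸ map_zero p⟩ }
  let : NormedAddCommGroup E := NormedAddCommGroup.ofCore hcore
  let : NormedSpace ℝ E := NormedSpace.ofCore hcore
  obtain ⟨s, hcard, hs1, hs⟩ := exists_sphere_net E hη0
  refine ⟨s, hcard, hs1, fun q hq x => ?_, fun q hq x =>
    abs_seminorm_sub_norm_le_of_net (q := q) (s := s) hη hs hq x⟩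
  refine (seminorm_le_of_net (s := s) (by linarith) hs hq x).trans ?_
  refine mul_le_mul_of_nonneg_right ?_ (apply_nonneg p x)
  rw [div_le_iff₀ (by linarith)]
  nlinarith

/-! ### Random samples approximate the uniform norm -/

section Sample

variable {d n : ℕ}

/-- The trace of `Δ` estimated from a sample `ω` of unit vectors: the average over the sample of
the density of the uniform POVM. -/
def empiricalMean (ω : Fin n → CSphere d) : Matrix (Fin d) (Fin d) ℂ →ₗ[ℝ] ℝ :=
  (n : ℝ)⁻¹ • ∑ j, uniformDensity (ω j)

theorem empiricalMean_apply (ω : Fin n → CSphere d) (Δ : Matrix (Fin d) (Fin d) ℂ) :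
    empiricalMean ω Δ = (n : ℝ)⁻¹ * ∑ j, uniformDensity (ω j) Δ := by
  simp [empiricalMean]

/-- The uniform norm of `Δ` estimated from a sample `ω` of unit vectors. -/
def empiricalNorm (ω : Fin n → CSphere d) : Seminorm ℝ (Matrix (Fin d) (Fin d) ℂ) :=
  Seminorm.of (fun Δ => (n : ℝ)⁻¹ * ∑ j, |uniformDensity (ω j) Δ|)
    (fun A B => by
      rw [← mul_add, ← Finset.sum_add_distrib]
      gcongr with j
      rw [map_add]
      exact abs_add_le _ _)
    (fun r A => by
      simp only [map_smul, smul_eq_mul, abs_mul, ← Finset.mul_sum, Real.norm_eq_abs,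
        mul_left_comm])

theorem empiricalNorm_apply (ω : Fin n → CSphere d) (Δ : Matrix (Fin d) (Fin d) ℂ) :
    empiricalNorm ω Δ = (n : ℝ)⁻¹ * ∑ j, |uniformDensity (ω j) Δ| := rfl

/-- The sample `ω` reproduces the uniform norm and the trace of all Hermitian matrices, up to a
relative error `δ` with respect to the uniform norm. -/
def IsApproximating (δ : ℝ) (ω : Fin n → CSphere d) : Prop :=
  ∀ Δ : Matrix (Fin d) (Fin d) ℂ, Δ.IsHermitian →
    |empiricalNorm ω Δ - uniformNorm d Δ| ≤ δ * uniformNorm d Δ ∧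
    |empiricalMean ω Δ - Δ.trace.re| ≤ δ * uniformNorm d Δ

theorem finrank_selfAdjoint_matrix_le (ι : Type*) [Fintype ι] :
    Module.finrank ℝ (selfAdjoint.submodule ℝ (Matrix ι ι ℂ)) ≤ 2 * Fintype.card ι ^ 2 := by
  refine (Submodule.finrank_le _).trans_eq ?_
  rw [← Module.finrank_mul_finrank ℝ ℂ, Complex.finrank_real_complex, Module.finrank_matrix,
    Module.finrank_self, mul_one, sq]

theorem eq_zero_of_uniformNorm_eq_zero [NeZero d] {Δ : Matrix (Fin d) (Fin d) ℂ}
    (hΔ : Δ.IsHermitian) (h : uniformNorm d Δ = 0) : Δ = 0 := by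
  open scoped Matrix.Norms.Frobenius in
  exact norm_le_zero_iff.1 ((frobenius_norm_le_uniformNorm hΔ).trans_eq (by rw [h, mul_zero]))

theorem exists_net_isApproximating (d : ℕ) [NeZero d] {η : ℝ} (hη0 : 0 < η) (hη : η ≤ 1 / 2) :
    ∃ s : Finset (Matrix (Fin d) (Fin d) ℂ), s.card ≤ (1 + 2 / η) ^ (2 * d ^ 2) ∧
      (∀ c ∈ s, c.IsHermitian ∧ uniformNorm d c = 1) ∧
      ∀ {n : ℕ} (ω : Fin n → CSphere d), (∀ c ∈ s, |empiricalNorm ω c - uniformNorm d c| ≤ η ∧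
        |empiricalMean ω c - c.trace.re| ≤ η) → IsApproximating (4 * η) ω := by
  classical
  let E := selfAdjoint.submodule ℝ (Matrix (Fin d) (Fin d) ℂ)
  obtain ⟨s, hcard, hs1, hsmall, hclose⟩ := exists_net_of_definite_seminorm
    ((uniformNorm d).comp E.subtype)
    (fun Δ h => Subtype.ext (eq_zero_of_uniformNorm_eq_zero Δ.2 h)) hη0 hη
  refine ⟨s.image E.subtype, ?_, ?_, fun ω hω Δ hΔ => ⟨?_, ?_⟩⟩
  · have hfinrank := finrank_selfAdjoint_matrix_le (Fin d)
    rw [Fintype.card_fin] at hfinrank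
    calc ((s.image E.subtype).card : ℝ) ≤ s.card := by exact_mod_cast Finset.card_image_le
      _ ≤ _ := hcard
      _ ≤ _ := pow_le_pow_right₀ (by rw [le_add_iff_nonneg_right]; positivity) hfinrank
  · simp only [Finset.mem_image]
    rintro _ ⟨c, hc, rfl⟩
    exact ⟨c.2, hs1 c hc⟩
  · refine hclose ((empiricalNorm ω).comp E.subtype) (fun c hc => ?_) ⟨Δ, hΔ⟩
    rw [← hs1 c hc]
    exact (hω c (Finset.mem_image_of_mem _ hc)).1
  · let error : Matrix (Fin d) (Fin d) ℂ →ₗ[ℝ] ℝ := empiricalMean ω -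
      Complex.reLm ∘ₗ Matrix.traceLinearMap (Fin d) ℝ ℂ
    exact hsmall ((normSeminorm ℝ ℝ).comp (error ∘ₗ E.subtype))
      (fun c hc => (hω c (Finset.mem_image_of_mem _ hc)).2) ⟨Δ, hΔ⟩

/-- The event that the sample `ω` estimates the uniform norm or the trace of `c` with an error of
at least `η`. -/
def badSamples (n : ℕ) (η : ℝ) (c : Matrix (Fin d) (Fin d) ℂ) : Set (Fin n → CSphere d) :=
  {ω | η ≤ |empiricalNorm ω c - uniformNorm d c|} ∪ {ω | η ≤ |empiricalMean ω c - c.trace.re|}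

theorem measure_badSamples_le [NeZero d] (hn : 0 < n) {η : ℝ} (hη0 : 0 ≤ η) (hη : η ≤ 32)
    {Δ : Matrix (Fin d) (Fin d) ℂ} (hΔ : Δ.IsHermitian) (h : uniformNorm d Δ ≤ 1 / 8) :
    (Measure.pi fun _ : Fin n => uniformSphere d).real (badSamples n η Δ)
      ≤ 4 * Real.exp (-(n * η ^ 2 / 128)) := by
  have hexp : Integrable (fun ψ => Real.exp |uniformDensity ψ Δ|) (uniformSphere d) :=
    integrable_uniformSphere_of_continuous (continuous_uniformDensity Δ).abs.rexp
  have h4 := integral_exp_abs_uniformDensity_le_four_of_uniformNorm_le hΔ h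
  have hmean := measure_pi_abs_average_sub_integral_ge_le (integrable_uniformDensity Δ) hexp
    four_pos h4 hη0 (by linarith) hn
  have hnorm := measure_pi_abs_average_sub_integral_ge_le (integrable_uniformDensity Δ).abs
    (by simpa only [abs_abs] using hexp) four_pos (by simpa only [abs_abs] using h4) hη0
    (by linarith) hn
  simp only [integral_uniformDensity, ← empiricalMean_apply] at hmean
  simp only [← uniformNorm_apply, ← empiricalNorm_apply] at hnorm
  norm_num at hmean hnorm
  exact (measureReal_union_le _ _).trans (by linarith)

theorem badSamples_smul (η : ℝ) {r : ℝ} (hr : 0 < r) (Δ : Matrix (Fin d) (Fin d) ℂ) :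
    badSamples n (r * η) (r • Δ) = badSamples n η Δ := by
  simp only [badSamples, map_smul_eq_mul, map_smul, Matrix.trace_smul, Complex.smul_re,
    smul_eq_mul, Real.norm_of_nonneg hr.le, ← mul_sub, abs_mul, abs_of_pos hr,
    mul_le_mul_iff_right₀ hr]

theorem measure_not_isApproximating_le [NeZero d] (hn : 0 < n) {η : ℝ} (hη0 : 0 < η)
    (hη : η ≤ 1 / 2) :
    (Measure.pi fun _ : Fin n => uniformSphere d).real {ω | ¬ IsApproximating (4 * η) ω}
      ≤ 4 * (1 + 2 / η) ^ (2 * d ^ 2) * Real.exp (-(n * η ^ 2 / 8192)) := by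
  obtain ⟨s, hcard, hs, hnet⟩ := exists_net_isApproximating d hη0 hη
  have hsub : {ω : Fin n → CSphere d | ¬ IsApproximating (4 * η) ω} ⊆
      ⋃ c ∈ s, badSamples n η c := by
    intro ω hω
    by_contra hcon
    refine hω (hnet ω fun c hc => ?_)
    have hgood : ω ∉ badSamples n η c := fun h => hcon (Set.mem_biUnion hc h)
    simp only [badSamples, Set.mem_union, Set.mem_ofPred_eq, not_or, not_le] at hgood
    exact ⟨hgood.1.le, hgood.2.le⟩
  have hbad (c) (hc : c ∈ s) : (Measure.pi fun _ : Fin n => uniformSphere d).real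
      (badSamples n η c) ≤ 4 * Real.exp (-(n * η ^ 2 / 8192)) := by
    have h := measure_badSamples_le hn (η := 8⁻¹ * η) (by positivity) (by linarith)
      ((hs c hc).1.smul (.all (8⁻¹ : ℝ))) (by rw [map_smul_eq_mul, (hs c hc).2]; norm_num)
    rw [badSamples_smul η (by norm_num) c] at h
    exact h.trans_eq (by ring_nf)
  calc _ ≤ _ := measureReal_mono hsub (measure_ne_top _ _)
    _ ≤ _ := measureReal_biUnion_finset_le _ _
    _ ≤ _ := Finset.sum_le_sum hbad
    _ = s.card * (4 * Real.exp (-(n * η ^ 2 / 8192))) := by rw [Finset.sum_const, nsmul_eq_mul]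
    _ ≤ (1 + 2 / η) ^ (2 * d ^ 2) * (4 * Real.exp (-(n * η ^ 2 / 8192))) := by gcongr
    _ = _ := by ring

end Sample

/-! ### Inverse square roots near the identity -/

section InvSqrt

variable {d : ℕ}

theorem isHermitian_invSqrt (S : Matrix (Fin d) (Fin d) ℂ) : (invSqrt S).IsHermitian :=
  (cfc_predicate _ S : IsSelfAdjoint _)

theorem invSqrt_smul {S : Matrix (Fin d) (Fin d) ℂ} (hS : S.IsHermitian) {r : ℝ} (hr : 0 ≤ r) :
    invSqrt (r • S) = (Real.sqrt r)⁻¹ • invSqrt S := by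
  rw [invSqrt, invSqrt, ← cfc_comp_smul r _ S
    ((Matrix.finite_real_spectrum.image _).continuousOn _) hS.isSelfAdjoint, ← cfc_smul _ _ S
    (Matrix.finite_real_spectrum.continuousOn _)]
  simp only [smul_eq_mul, Real.sqrt_mul hr, mul_inv]

theorem invSqrt_mul_self_mul_invSqrt {S : Matrix (Fin d) (Fin d) ℂ} (hS : S.PosDef) :
    invSqrt S * S * invSqrt S = 1 := by
  have hcont (f : ℝ → ℝ) : ContinuousOn f (spectrum ℝ S) :=
    Matrix.finite_real_spectrum.continuousOn f
  have hsa : IsSelfAdjoint S := hS.isHermitian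
  calc invSqrt S * S * invSqrt S
      = cfc (fun x : ℝ => (Real.sqrt x)⁻¹ * x * (Real.sqrt x)⁻¹) S := by
        rw [cfc_mul _ _ S (hcont _) (hcont _), cfc_mul _ _ S (hcont _) (hcont _), cfc_id' ℝ S,
          invSqrt]
    _ = cfc (fun _ : ℝ => (1 : ℝ)) S := by
        refine cfc_congr fun x hx => ?_
        rw [hS.isHermitian.spectrum_real_eq_range_eigenvalues] at hx
        obtain ⟨i, rfl⟩ := hx
        have hsqrt := (Real.sqrt_pos.2 (hS.eigenvalues_pos i)).ne'
        field_simp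
        exact (Real.sq_sqrt (hS.eigenvalues_pos i).le).symm
    _ = 1 := cfc_const_one ℝ S

theorem abs_inv_sqrt_sub_one_le {y : ℝ} (hy : |y - 1| ≤ 1 / 2) :
    |(Real.sqrt y)⁻¹ - 1| ≤ 2 * |y - 1| := by
  have hy0 : 1 / 2 ≤ y := by linarith [(abs_le.1 hy).1]
  set u := Real.sqrt y
  have hu0 : 1 / 2 ≤ u := Real.le_sqrt_of_sq_le (by linarith)
  have hfac : y - 1 = (u⁻¹ - 1) * -(u * (u + 1)) := by
    rw [← Real.sq_sqrt (by linarith : 0 ≤ y)]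
    change u ^ 2 - 1 = _
    field_simp
    ring
  have hu : 1 ≤ 2 * (u * (u + 1)) := by nlinarith
  rw [hfac, abs_mul, abs_neg, abs_of_pos (by positivity : 0 < u * (u + 1))]
  nlinarith [abs_nonneg (u⁻¹ - 1)]

open scoped Matrix.Norms.Frobenius

theorem cfc_sub_one_of_isHermitian {T : Matrix (Fin d) (Fin d) ℂ} (hT : T.IsHermitian)
    (f : ℝ → ℝ) : cfc (fun x => f x - 1) T = cfc f T - 1 := by
  rw [cfc_sub f _ T (Matrix.finite_real_spectrum.continuousOn f), cfc_const_one ℝ T]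

theorem abs_eigenvalue_sub_one_le_frobenius_norm {T : Matrix (Fin d) (Fin d) ℂ}
    (hT : T.IsHermitian) (i : Fin d) : |hT.eigenvalues i - 1| ≤ ‖T - 1‖ := by
  have h := abs_apply_eigenvalue_le_frobenius_norm_cfc hT (fun x => x - 1) i
  rwa [cfc_sub_one_of_isHermitian hT, cfc_id' ℝ T] at h

theorem posDef_of_frobenius_norm_sub_one_lt {T : Matrix (Fin d) (Fin d) ℂ} (hT : T.IsHermitian)
    (h : ‖T - 1‖ < 1) : T.PosDef :=
  hT.posDef_iff_eigenvalues_pos.2 fun i => by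
    linarith [(abs_lt.1 ((abs_eigenvalue_sub_one_le_frobenius_norm hT i).trans_lt h)).1]

theorem frobenius_norm_invSqrt_sub_one_le {T : Matrix (Fin d) (Fin d) ℂ} (hT : T.IsHermitian)
    (h : ‖T - 1‖ ≤ 1 / 2) : ‖invSqrt T - 1‖ ≤ 2 * ‖T - 1‖ := by
  refine le_of_sq_le_sq ?_ (by positivity)
  have hsub : ‖T - 1‖ ^ 2 = ∑ i, (hT.eigenvalues i - 1) ^ 2 := by
    rw [← frobenius_norm_sq_cfc hT fun x => x - 1, cfc_sub_one_of_isHermitian hT, cfc_id' ℝ T]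
  rw [invSqrt, ← cfc_sub_one_of_isHermitian hT, frobenius_norm_sq_cfc hT, mul_pow, hsub,
    Finset.mul_sum]
  gcongr with i
  rw [← mul_pow, sq_le_sq, abs_mul, abs_two]
  exact abs_inv_sqrt_sub_one_le ((abs_eigenvalue_sub_one_le_frobenius_norm hT i).trans h)

theorem norm_trace_mul_le {m n : Type*} [Fintype m] [Fintype n] (A : Matrix m n ℂ)
    (B : Matrix n m ℂ) : ‖(A * B).trace‖ ≤ ‖A‖ * ‖B‖ := by
  have hA : ‖A‖ ^ 2 = ∑ p : m × n, ‖A p.1 p.2‖ ^ 2 := by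
    rw [frobenius_norm_sq_eq_sum, Fintype.sum_prod_type]
  have hB : ‖B‖ ^ 2 = ∑ p : m × n, ‖B p.2 p.1‖ ^ 2 := by
    rw [frobenius_norm_sq_eq_sum, Fintype.sum_prod_type, Finset.sum_comm]
  calc ‖(A * B).trace‖ = ‖∑ p : m × n, A p.1 p.2 * B p.2 p.1‖ := by
        simp only [Matrix.trace, Matrix.diag_apply, Matrix.mul_apply, Fintype.sum_prod_type]
    _ ≤ ∑ p : m × n, ‖A p.1 p.2‖ * ‖B p.2 p.1‖ := norm_sum_le_of_le _ fun p _ => (norm_mul _ _).le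
    _ ≤ Real.sqrt (‖A‖ ^ 2) * Real.sqrt (‖B‖ ^ 2) := by
        rw [hA, hB]
        exact Real.sum_mul_le_sqrt_mul_sqrt _ _ _
    _ = ‖A‖ * ‖B‖ := by rw [Real.sqrt_sq (norm_nonneg _), Real.sqrt_sq (norm_nonneg _)]

theorem isHermitian_mul_mul_self {R Δ : Matrix (Fin d) (Fin d) ℂ} (hR : R.IsHermitian)
    (hΔ : Δ.IsHermitian) : (R * Δ * R).IsHermitian := by
  simpa only [hR.eq] using Matrix.isHermitian_conjTranspose_mul_mul R hΔ

theorem uniformNorm_conj_sub_le [NeZero d] {R Δ : Matrix (Fin d) (Fin d) ℂ}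
    (hR : R.IsHermitian) (hΔ : Δ.IsHermitian) (hR1 : ‖R - 1‖ ≤ 1) :
    uniformNorm d (R * Δ * R - Δ) ≤ 192 * ‖R - 1‖ * uniformNorm d Δ := by
  have hdecomp : R * Δ * R - Δ = (R - 1) * Δ + R * Δ * (R - 1) := by noncomm_ring
  have hleft : ‖R * Δ‖ ≤ 2 * ‖Δ‖ := by
    calc ‖R * Δ‖ = ‖(R - 1) * Δ + Δ‖ := by rw [Matrix.sub_mul, one_mul, sub_add_cancel]
      _ ≤ ‖R - 1‖ * ‖Δ‖ + ‖Δ‖ := norm_add_le_of_le (Matrix.frobenius_norm_mul _ _) le_rfl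
      _ ≤ 2 * ‖Δ‖ := by nlinarith [norm_nonneg Δ]
  have hsum : ‖R - 1‖ * ‖Δ‖ + ‖R * Δ‖ * ‖R - 1‖ ≤ 3 * ‖R - 1‖ * ‖Δ‖ := by
    nlinarith [norm_nonneg (R - 1)]
  have hnorm : ‖R * Δ * R - Δ‖ ≤ 3 * ‖R - 1‖ * ‖Δ‖ := by
    rw [hdecomp]
    exact (norm_add_le_of_le (Matrix.frobenius_norm_mul _ _)
      (Matrix.frobenius_norm_mul _ _)).trans hsum
  have htrace : |(R * Δ * R - Δ).trace.re| ≤ 3 * ‖R - 1‖ * ‖Δ‖ := by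
    rw [hdecomp, Matrix.trace_add]
    exact (Complex.abs_re_le_norm _).trans
      ((norm_add_le_of_le (norm_trace_mul_le _ _) (norm_trace_mul_le _ _)).trans hsum)
  calc uniformNorm d (R * Δ * R - Δ)
      ≤ 8 * (‖R * Δ * R - Δ‖ + |(R * Δ * R - Δ).trace.re|) :=
        uniformNorm_le ((isHermitian_mul_mul_self hR hΔ).sub hΔ)
    _ ≤ 48 * ‖R - 1‖ * ‖Δ‖ := by linarith
    _ ≤ 48 * ‖R - 1‖ * (4 * uniformNorm d Δ) := by gcongr; exact frobenius_norm_le_uniformNorm hΔ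
    _ = 192 * ‖R - 1‖ * uniformNorm d Δ := by ring

end InvSqrt

/-! ### From a good sample to the normalized discrete POVM -/

section Normalize

variable {d n : ℕ}

/-- The frame operator `S = P₁ + ⋯ + Pₙ` of a sample of unit vectors, rescaled by `d / n` so that
its expectation is `1`. -/
def frameOperator (ω : Fin n → CSphere d) : Matrix (Fin d) (Fin d) ℂ :=
  (d / n : ℝ) • ∑ j, rankOne (ω j).1

theorem isHermitian_sum_rankOne (ω : Fin n → CSphere d) : (∑ j, rankOne (ω j).1).IsHermitian :=
  isSelfAdjoint_sum _ fun j _ => (Matrix.posSemidef_vecMulVec_self_star (ω j).1.ofLp).isHermitian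

theorem isHermitian_frameOperator (ω : Fin n → CSphere d) : (frameOperator ω).IsHermitian :=
  (isHermitian_sum_rankOne ω).smul (.all _)

theorem trace_rankOne (ψ : CSphere d) : (rankOne ψ.1).trace = 1 := by
  rw [rankOne, Matrix.trace_vecMulVec, ← EuclideanSpace.inner_eq_star_dotProduct,
    inner_self_eq_norm_sq_to_K, norm_eq_of_mem_sphere ψ]
  simp

theorem trace_frameOperator [NeZero d] (hn : 0 < n) (ω : Fin n → CSphere d) :
    (frameOperator ω).trace = d := by
  have hn' : (n : ℂ) ≠ 0 := Nat.cast_ne_zero.2 hn.ne'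
  rw [frameOperator, Matrix.trace_smul, Matrix.trace_sum]
  simp [trace_rankOne, hn']

theorem empiricalMean_eq (ω : Fin n → CSphere d) (Δ : Matrix (Fin d) (Fin d) ℂ) :
    empiricalMean ω Δ = (Δ * frameOperator ω).trace.re := by
  rw [frameOperator, Matrix.mul_smul, Matrix.trace_smul, Complex.smul_re, smul_eq_mul,
    Finset.mul_sum, Matrix.trace_sum, Complex.re_sum, empiricalMean_apply]
  simp only [uniformDensity_apply, ← Finset.mul_sum, expect]
  ring

theorem normalizedFamily_eq [NeZero d] (hn : 0 < n) (ω : Fin n → CSphere d) (j : Fin n) :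
    normalizedFamily ω j = (d / n : ℝ) •
      (invSqrt (frameOperator ω) * rankOne (ω j).1 * invSqrt (frameOperator ω)) := by
  have hd : 0 < d := NeZero.pos d
  have hr : (0 : ℝ) < d / n := by positivity
  rw [frameOperator, invSqrt_smul (isHermitian_sum_rankOne ω) hr.le]
  simp only [Matrix.smul_mul, Matrix.mul_smul, smul_smul]
  rw [mul_assoc, ← mul_inv, Real.mul_self_sqrt hr.le, mul_inv_cancel₀ hr.ne', one_smul,
    normalizedFamily, Matrix.mul_assoc]

theorem isDiscretePOVM_normalizedFamily [NeZero d] (hn : 0 < n) {ω : Fin n → CSphere d}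
    (hω : (frameOperator ω).PosDef) : IsDiscretePOVM (normalizedFamily ω) := by
  refine ⟨fun j => ?_, ?_⟩
  · have h := (Matrix.posSemidef_vecMulVec_self_star (ω j).1.ofLp).conjTranspose_mul_mul_same
      (invSqrt (∑ l, rankOne (ω l).1))
    rwa [(isHermitian_invSqrt _).eq] at h
  · simp only [normalizedFamily_eq hn, ← Finset.smul_sum, ← Finset.sum_mul, ← Finset.mul_sum]
    rw [← Matrix.smul_mul, ← Matrix.mul_smul]
    exact invSqrt_mul_self_mul_invSqrt hω

theorem discreteDistNorm_normalizedFamily [NeZero d] (hn : 0 < n) (ω : Fin n → CSphere d)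
    {Δ : Matrix (Fin d) (Fin d) ℂ} (hΔ : Δ.IsHermitian) :
    discreteDistNorm (normalizedFamily ω) Δ =
      empiricalNorm ω (invSqrt (frameOperator ω) * Δ * invSqrt (frameOperator ω)) := by
  have hRΔ := isHermitian_mul_mul_self (isHermitian_invSqrt (frameOperator ω)) hΔ
  set R := invSqrt (frameOperator ω)
  rw [discreteDistNorm, empiricalNorm_apply, Finset.mul_sum]
  refine Finset.sum_congr rfl fun j _ => ?_
  have hcyclic : (Δ * normalizedFamily ω j).trace
      = (d / n : ℝ) • (R * Δ * R * rankOne (ω j).1).trace := by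
    rw [normalizedFamily_eq hn, Matrix.mul_smul, Matrix.trace_smul, ← Matrix.mul_assoc,
      Matrix.trace_mul_comm]
    simp only [R, Matrix.mul_assoc]
  rw [hcyclic, trace_mul_rankOne_eq_expect hRΔ, norm_smul, Complex.norm_real, Real.norm_eq_abs,
    Real.norm_eq_abs, uniformDensity_apply, abs_mul, abs_div, Nat.abs_cast, Nat.abs_cast]
  ring

open scoped Matrix.Norms.Frobenius

theorem frobenius_norm_frameOperator_sub_one_le [NeZero d] (hn : 0 < n) {ω : Fin n → CSphere d}
    {δ : ℝ} (hδ : 0 ≤ δ) (hω : IsApproximating δ ω) : ‖frameOperator ω - 1‖ ≤ 8 * δ := by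
  set T := frameOperator ω
  have hT : (T - 1).IsHermitian := (isHermitian_frameOperator ω).sub Matrix.isHermitian_one
  have htrace : (T - 1).trace = 0 := by
    rw [Matrix.trace_sub, trace_frameOperator hn, Matrix.trace_one, Fintype.card_fin, sub_self]
  -- the deviation of the empirical trace, tested on `T - 1` itself, is `tr ((T - 1) (T - 1))`
  have hself : empiricalMean ω (T - 1) - (T - 1).trace.re = ‖T - 1‖ ^ 2 := by
    rw [empiricalMean_eq, frobenius_norm_sq_eq_trace, hT.eq, ← Complex.sub_re, ← Matrix.trace_sub,
      Matrix.mul_sub, mul_one]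
  have huniform := uniformNorm_le hT
  rw [htrace, Complex.zero_re, abs_zero, add_zero] at huniform
  have hsq : ‖T - 1‖ ^ 2 ≤ δ * (8 * ‖T - 1‖) := by
    calc ‖T - 1‖ ^ 2 ≤ δ * uniformNorm d (T - 1) := by
          rw [← hself]
          exact (le_abs_self _).trans (hω _ hT).2
      _ ≤ δ * (8 * ‖T - 1‖) := by gcongr
  by_contra! hcon
  nlinarith [norm_nonneg (T - 1)]

theorem normalizedFamily_spec [NeZero d] (hn : 0 < n) {ω : Fin n → CSphere d} {ε : ℝ}
    (hε0 : 0 ≤ ε) (hε1 : ε ≤ 1) (hω : IsApproximating (ε / 4096) ω) :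
    IsDiscretePOVM (normalizedFamily ω) ∧ ∀ Δ : Matrix (Fin d) (Fin d) ℂ, Δ.IsHermitian →
      |discreteDistNorm (normalizedFamily ω) Δ - uniformNorm d Δ| ≤ ε * uniformNorm d Δ := by
  have hT := isHermitian_frameOperator ω
  have hT1 := frobenius_norm_frameOperator_sub_one_le hn (by positivity) hω
  refine ⟨isDiscretePOVM_normalizedFamily hn (posDef_of_frobenius_norm_sub_one_lt hT
    (by linarith)), fun Δ hΔ => ?_⟩
  rw [discreteDistNorm_normalizedFamily hn ω hΔ]
  have hR1 := frobenius_norm_invSqrt_sub_one_le hT (by linarith)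
  have hRh := isHermitian_invSqrt (frameOperator ω)
  set R := invSqrt (frameOperator ω)
  have hU := apply_nonneg (uniformNorm d) Δ
  have hconj : uniformNorm d (R * Δ * R - Δ) ≤ 3 / 4 * ε * uniformNorm d Δ :=
    (uniformNorm_conj_sub_le hRh hΔ (by linarith)).trans
      (mul_le_mul_of_nonneg_right (by linarith) hU)
  have hdiff := (abs_sub_map_le_sub (uniformNorm d) (R * Δ * R) Δ).trans hconj
  have hsample := (hω (R * Δ * R) (isHermitian_mul_mul_self hRh hΔ)).1
  have htwo : uniformNorm d (R * Δ * R) ≤ 2 * uniformNorm d Δ := by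
    nlinarith [(abs_le.1 hdiff).2]
  calc |empiricalNorm ω (R * Δ * R) - uniformNorm d Δ|
      ≤ |empiricalNorm ω (R * Δ * R) - uniformNorm d (R * Δ * R)| +
        |uniformNorm d (R * Δ * R) - uniformNorm d Δ| := abs_sub_le _ _ _
    _ ≤ ε / 4096 * (2 * uniformNorm d Δ) + 3 / 4 * ε * uniformNorm d Δ :=
        add_le_add (hsample.trans (by gcongr)) hdiff
    _ ≤ ε * uniformNorm d Δ := by nlinarith

end Normalize

/-! ### Tensor products of comparable densities -/

section Density

variable {ι X : Type*} [Fintype ι] [MeasurableSpace X]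

/-- The distinguishability norm `∫ |tr (Δ F)| dμ` of the operator-valued measure `A ↦ ∫_A F dμ`.
It covers discrete POVMs, for which `μ` is the counting measure. -/
def densityNorm (μ : Measure X) (F : X → Matrix ι ι ℂ) (Δ : Matrix ι ι ℂ) : ENNReal :=
  ∫⁻ x, ‖(Δ * F x).trace‖ₑ ∂μ

theorem measurable_trace_mul {F : X → Matrix ι ι ℂ} (hF : ∀ a b, Measurable fun x => F x a b)
    (Δ : Matrix ι ι ℂ) : Measurable fun x => (Δ * F x).trace := by
  simp only [Matrix.trace, Matrix.diag_apply, Matrix.mul_apply]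
  fun_prop

end Density

section Kronecker

open scoped Kronecker

variable {m n X X' Y Y' : Type*} [Fintype m] [Fintype n] [MeasurableSpace X] [MeasurableSpace X']
  [MeasurableSpace Y] [MeasurableSpace Y']

/-- The contraction `tr_n (Δ (1 ⊗ B))` of an operator on a tensor product against an operator `B`
on the second factor. -/
def partialContraction (Δ : Matrix (m × n) (m × n) ℂ) (B : Matrix n n ℂ) : Matrix m m ℂ :=
  Matrix.of fun a b => ∑ i, ∑ j, Δ (a, i) (b, j) * B j i

theorem trace_mul_kronecker (Δ : Matrix (m × n) (m × n) ℂ) (A : Matrix m m ℂ) (B : Matrix n n ℂ) :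
    (Δ * (A ⊗ₖ B)).trace = (partialContraction Δ B * A).trace := by
  simp only [Matrix.trace, Matrix.diag_apply, Matrix.mul_apply, partialContraction, Matrix.of_apply,
    Finset.sum_mul, Fintype.sum_prod_type, Matrix.kronecker_apply]
  refine Finset.sum_congr rfl fun a _ => ?_
  rw [Finset.sum_comm]
  simp only [mul_assoc, mul_comm]

omit [Fintype m] in
theorem isHermitian_partialContraction {Δ : Matrix (m × n) (m × n) ℂ} (hΔ : Δ.IsHermitian)
    {B : Matrix n n ℂ} (hB : B.IsHermitian) : (partialContraction Δ B).IsHermitian := by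
  ext a b
  simp only [partialContraction, Matrix.conjTranspose_apply, Matrix.of_apply, star_sum, star_mul']
  rw [Finset.sum_comm]
  simp only [hΔ.apply, hB.apply]

theorem trace_submatrix_mul_submatrix (e : m ≃ n) (A B : Matrix n n ℂ) :
    (A.submatrix e e * B.submatrix e e).trace = (A * B).trace := by
  rw [Matrix.submatrix_mul_equiv]
  exact e.sum_comp fun i => (A * B) i i

theorem densityNorm_kronecker_swap (μ : Measure X) (ν : Measure Y) [SFinite μ] [SFinite ν]
    (F : X → Matrix m m ℂ) (G : Y → Matrix n n ℂ) (Δ : Matrix (m × n) (m × n) ℂ) :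
    densityNorm (μ.prod ν) (fun p => F p.1 ⊗ₖ G p.2) Δ =
      densityNorm (ν.prod μ) (fun p => G p.1 ⊗ₖ F p.2) (Δ.submatrix Prod.swap Prod.swap) := by
  rw [densityNorm, ← lintegral_prod_swap]
  refine lintegral_congr fun p => ?_
  rw [← trace_submatrix_mul_submatrix (Equiv.prodComm n m)]
  congr 3
  ext i j
  exact mul_comm _ _

theorem measurable_trace_mul_kronecker {F : X → Matrix m m ℂ} {G : Y → Matrix n n ℂ}
    (hF : ∀ a b, Measurable fun x => F x a b) (hG : ∀ a b, Measurable fun y => G y a b)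
    (Δ : Matrix (m × n) (m × n) ℂ) :
    Measurable fun p : X × Y => (Δ * (F p.1 ⊗ₖ G p.2)).trace := by
  refine measurable_trace_mul (F := fun p : X × Y => F p.1 ⊗ₖ G p.2) (fun a b => ?_) Δ
  change Measurable fun p : X × Y => F p.1 a.1 b.1 * G p.2 a.2 b.2
  exact ((hF a.1 b.1).comp measurable_fst).mul ((hG a.2 b.2).comp measurable_snd)

theorem densityNorm_kronecker_le_left {c : ENNReal} {μ : Measure X} {μ' : Measure X'}
    {ν : Measure Y} [SFinite μ] [SFinite μ'] [SFinite ν] {F : X → Matrix m m ℂ}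
    {F' : X' → Matrix m m ℂ} {G : Y → Matrix n n ℂ}
    (hF : ∀ a b, Measurable fun x => F x a b) (hF' : ∀ a b, Measurable fun x => F' x a b)
    (hG : ∀ a b, Measurable fun y => G y a b) (hG_herm : ∀ y, (G y).IsHermitian)
    (h : ∀ Δ : Matrix m m ℂ, Δ.IsHermitian → densityNorm μ F Δ ≤ c * densityNorm μ' F' Δ)
    {Δ : Matrix (m × n) (m × n) ℂ} (hΔ : Δ.IsHermitian) :
    densityNorm (μ.prod ν) (fun p => F p.1 ⊗ₖ G p.2) Δ ≤
      c * densityNorm (μ'.prod ν) (fun p => F' p.1 ⊗ₖ G p.2) Δ := by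
  have hm := (measurable_trace_mul_kronecker hF hG Δ).enorm
  have hm' := (measurable_trace_mul_kronecker hF' hG Δ).enorm
  simp only [densityNorm]
  rw [lintegral_prod_symm' _ hm, lintegral_prod_symm' _ hm',
    ← lintegral_const_mul _ hm'.lintegral_prod_left']
  refine lintegral_mono fun y => ?_
  simp only [trace_mul_kronecker]
  exact h _ (isHermitian_partialContraction hΔ (hG_herm y))

theorem densityNorm_kronecker_le {c c' : ENNReal} {μ : Measure X} {μ' : Measure X'}
    {ν : Measure Y} {ν' : Measure Y'} [SFinite μ] [SFinite μ'] [SFinite ν] [SFinite ν']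
    {F : X → Matrix m m ℂ} {F' : X' → Matrix m m ℂ} {G : Y → Matrix n n ℂ} {G' : Y' → Matrix n n ℂ}
    (hF : ∀ a b, Measurable fun x => F x a b) (hF' : ∀ a b, Measurable fun x => F' x a b)
    (hG : ∀ a b, Measurable fun y => G y a b) (hG' : ∀ a b, Measurable fun y => G' y a b)
    (hF'_herm : ∀ x, (F' x).IsHermitian) (hG_herm : ∀ y, (G y).IsHermitian)
    (hFF' : ∀ Δ : Matrix m m ℂ, Δ.IsHermitian → densityNorm μ F Δ ≤ c * densityNorm μ' F' Δ)
    (hGG' : ∀ Δ : Matrix n n ℂ, Δ.IsHermitian → densityNorm ν G Δ ≤ c' * densityNorm ν' G' Δ)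
    {Δ : Matrix (m × n) (m × n) ℂ} (hΔ : Δ.IsHermitian) :
    densityNorm (μ.prod ν) (fun p => F p.1 ⊗ₖ G p.2) Δ ≤
      c * c' * densityNorm (μ'.prod ν') (fun p => F' p.1 ⊗ₖ G' p.2) Δ := by
  calc _ ≤ c * densityNorm (μ'.prod ν) (fun p => F' p.1 ⊗ₖ G p.2) Δ :=
        densityNorm_kronecker_le_left hF hF' hG hG_herm hFF' hΔ
    _ ≤ c * (c' * densityNorm (μ'.prod ν') (fun p => F' p.1 ⊗ₖ G' p.2) Δ) := by
        rw [densityNorm_kronecker_swap, densityNorm_kronecker_swap μ' ν']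
        gcongr
        exact densityNorm_kronecker_le_left hG hG' hF' hF'_herm hGG' (hΔ.submatrix _)
    _ = _ := (mul_assoc _ _ _).symm

end Kronecker

section Tensor

open scoped Kronecker

theorem tensorMatrix_submatrix_consEquiv {k : ℕ} {d : Fin (k + 1) → ℕ}
    (A : ∀ i, Matrix (Fin (d i)) (Fin (d i)) ℂ) :
    (tensorMatrix A).submatrix (Fin.consEquiv fun i => Fin (d i)) (Fin.consEquiv fun i => Fin (d i))
      = A 0 ⊗ₖ tensorMatrix fun i => A i.succ := by
  ext a b
  simp [tensorMatrix, Fin.prod_univ_succ, Fin.consEquiv]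

theorem isHermitian_tensorMatrix {k : ℕ} {d : Fin k → ℕ}
    {A : ∀ i, Matrix (Fin (d i)) (Fin (d i)) ℂ} (hA : ∀ i, (A i).IsHermitian) :
    (tensorMatrix A).IsHermitian := by
  ext a b
  simp only [tensorMatrix, Matrix.conjTranspose_apply, Matrix.of_apply, star_prod, (hA _).apply]

theorem measurable_tensorMatrix {k : ℕ} {d : Fin k → ℕ} {X : Fin k → Type*}
    [∀ i, MeasurableSpace (X i)] {F : ∀ i, X i → Matrix (Fin (d i)) (Fin (d i)) ℂ}
    (hF : ∀ i a b, Measurable fun x => F i x a b) (a b : ∀ i, Fin (d i)) :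
    Measurable fun x : ∀ i, X i => tensorMatrix (fun i => F i (x i)) a b := by
  simp only [tensorMatrix, Matrix.of_apply]
  exact Finset.measurable_prod _ fun i _ => (hF i (a i) (b i)).comp (measurable_pi_apply i)

theorem densityNorm_tensorMatrix_succ {k : ℕ} {d : Fin (k + 1) → ℕ} {X : Fin (k + 1) → Type*}
    [∀ i, MeasurableSpace (X i)] (μ : ∀ i, Measure (X i)) [∀ i, SigmaFinite (μ i)]
    (F : ∀ i, X i → Matrix (Fin (d i)) (Fin (d i)) ℂ)
    (Δ : Matrix (∀ i, Fin (d i)) (∀ i, Fin (d i)) ℂ) :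
    densityNorm (Measure.pi μ) (fun x => tensorMatrix fun i => F i (x i)) Δ =
      densityNorm ((μ 0).prod (Measure.pi fun i => μ (Fin.succ i)))
        (fun p => F 0 p.1 ⊗ₖ tensorMatrix fun i => F (Fin.succ i) (p.2 i))
        (Δ.submatrix (Fin.consEquiv fun i => Fin (d i)) (Fin.consEquiv fun i => Fin (d i))) := by
  rw [densityNorm, ← ((measurePreserving_piFinSuccAbove μ 0).symm _).lintegral_comp_emb
    (MeasurableEquiv.measurableEmbedding _)]
  refine lintegral_congr fun p => ?_
  rw [← trace_submatrix_mul_submatrix (Fin.consEquiv fun i => Fin (d i)),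
    tensorMatrix_submatrix_consEquiv]
  rfl

theorem densityNorm_tensorMatrix_le {c : ENNReal} {k : ℕ} {d : Fin k → ℕ} {X Y : Fin k → Type*}
    [∀ i, MeasurableSpace (X i)] [∀ i, MeasurableSpace (Y i)] {μ : ∀ i, Measure (X i)}
    {ν : ∀ i, Measure (Y i)} [∀ i, SigmaFinite (μ i)] [∀ i, SigmaFinite (ν i)]
    {F : ∀ i, X i → Matrix (Fin (d i)) (Fin (d i)) ℂ}
    {G : ∀ i, Y i → Matrix (Fin (d i)) (Fin (d i)) ℂ}
    (hF : ∀ i a b, Measurable fun x => F i x a b) (hG : ∀ i a b, Measurable fun y => G i y a b)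
    (hF_herm : ∀ i x, (F i x).IsHermitian) (hG_herm : ∀ i y, (G i y).IsHermitian)
    (h : ∀ i (Δ : Matrix (Fin (d i)) (Fin (d i)) ℂ), Δ.IsHermitian →
      densityNorm (μ i) (F i) Δ ≤ c * densityNorm (ν i) (G i) Δ)
    {Δ : Matrix (∀ i, Fin (d i)) (∀ i, Fin (d i)) ℂ} (hΔ : Δ.IsHermitian) :
    densityNorm (Measure.pi μ) (fun x => tensorMatrix fun i => F i (x i)) Δ ≤
      c ^ k * densityNorm (Measure.pi ν) (fun y => tensorMatrix fun i => G i (y i)) Δ := by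
  induction k with
  | zero =>
    have hF_const (x : ∀ i, X i) :
        (tensorMatrix fun i => F i (x i)) = tensorMatrix isEmptyElim :=
      congrArg tensorMatrix (funext isEmptyElim)
    have hG_const (y : ∀ i, Y i) :
        (tensorMatrix fun i => G i (y i)) = tensorMatrix isEmptyElim :=
      congrArg tensorMatrix (funext isEmptyElim)
    simp [densityNorm, hF_const, hG_const]
  | succ k ih =>
    rw [densityNorm_tensorMatrix_succ, densityNorm_tensorMatrix_succ, pow_succ']
    exact densityNorm_kronecker_le (hF 0) (hG 0) (measurable_tensorMatrix fun i => hF i.succ)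
      (measurable_tensorMatrix fun i => hG i.succ) (hG_herm 0)
      (fun x => isHermitian_tensorMatrix fun i => hF_herm i.succ (x i)) (h 0)
      (fun _ => ih (fun i => hF i.succ) (fun i => hG i.succ) (fun i => hF_herm i.succ)
        (fun i => hG_herm i.succ) (fun i => h i.succ)) (hΔ.submatrix _)

end Tensor

/-! ### The distinguishability norm of a POVM with a density -/

theorem iSup_setIntegral_sub_setIntegral_compl {Ω : Type*} [MeasurableSpace Ω] {μ : Measure Ω}
    {g : Ω → ℝ} (hgm : Measurable g) (hg : Integrable g μ) :
    ⨆ A : {A : Set Ω // MeasurableSet A}, (∫ ω in A.1, g ω ∂μ - ∫ ω in (A.1)ᶜ, g ω ∂μ)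
      = ∫ ω, |g ω| ∂μ := by
  have hle (A : {A : Set Ω // MeasurableSet A}) :
      ∫ ω in A.1, g ω ∂μ - ∫ ω in (A.1)ᶜ, g ω ∂μ ≤ ∫ ω, |g ω| ∂μ := by
    rw [← integral_add_compl A.2 hg.abs]
    exact (sub_le_sub (le_of_abs_le abs_integral_le_integral_abs)
      (neg_le_of_abs_le abs_integral_le_integral_abs)).trans_eq (sub_neg_eq_add _ _)
  have hpos : MeasurableSet {ω | 0 ≤ g ω} := measurableSet_le measurable_const hgm
  have heq : ∫ ω in {ω | 0 ≤ g ω}, g ω ∂μ - ∫ ω in {ω | 0 ≤ g ω}ᶜ, g ω ∂μ = ∫ ω, |g ω| ∂μ := by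
    rw [← integral_add_compl hpos hg.abs, sub_eq_add_neg, ← integral_neg]
    congr 1
    · exact setIntegral_congr_fun hpos fun ω hω => (abs_of_nonneg hω).symm
    · exact setIntegral_congr_fun hpos.compl fun ω (hω : ¬ 0 ≤ g ω) =>
        (abs_of_neg (not_le.1 hω)).symm
  refine le_antisymm (ciSup_le hle) (heq.symm.trans_le ?_)
  exact le_ciSup (f := fun A : {A : Set Ω // MeasurableSet A} =>
    ∫ ω in A.1, g ω ∂μ - ∫ ω in (A.1)ᶜ, g ω ∂μ) ⟨_, Set.forall_mem_range.2 hle⟩ ⟨_, hpos⟩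

section OfDensity

variable {Ω ι : Type*} [MeasurableSpace Ω] [Fintype ι] {μ : Measure Ω} {F : Ω → Matrix ι ι ℂ}

theorem integrable_trace_mul (hF : ∀ a b, Integrable (fun ω => F ω a b) μ) (Δ : Matrix ι ι ℂ) :
    Integrable (fun ω => (Δ * F ω).trace) μ := by
  simp only [Matrix.trace, Matrix.diag_apply, Matrix.mul_apply]
  exact integrable_finsetSum _ fun a _ => integrable_finsetSum _ fun b _ => (hF b a).const_mul _

theorem trace_mul_densityVectorMeasure (hF : ∀ a b, Integrable (fun ω => F ω a b) μ)
    (Δ : Matrix ι ι ℂ) {A : Set Ω} (hA : MeasurableSet A) :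
    (Δ * densityVectorMeasure μ F hF A).trace = ∫ ω in A, (Δ * F ω).trace ∂μ := by
  have h_int (a b) : Integrable (fun ω => Δ a b * F ω b a) (μ.restrict A) :=
    (hF b a).restrict.const_mul _
  simp only [Matrix.trace, Matrix.diag_apply, Matrix.mul_apply]
  rw [integral_finsetSum _ fun a _ => integrable_finsetSum _ fun b _ => h_int a b]
  simp only [integral_finsetSum _ fun b _ => h_int _ b, integral_const_mul,
    densityVectorMeasure_apply μ F hF hA]

theorem POVM.distNorm_ofDensity [DecidableEq ι] (hF : ∀ a b, Integrable (fun ω => F ω a b) μ)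
    (hpos : ∀ ω, (F ω).PosSemidef) (hone : ∀ a b, ∫ ω, F ω a b ∂μ = (1 : Matrix ι ι ℂ) a b)
    (hm : ∀ a b, Measurable fun ω => F ω a b) (Δ : Matrix ι ι ℂ) :
    (POVM.ofDensity μ F hF hpos hone).distNorm Δ = ∫ ω, |(Δ * F ω).trace.re| ∂μ := by
  have h_int := integrable_trace_mul hF Δ
  have hre {A : Set Ω} (hA : MeasurableSet A) : (Δ * densityVectorMeasure μ F hF A).trace.re
      = ∫ ω in A, (Δ * F ω).trace.re ∂μ := by
    rw [trace_mul_densityVectorMeasure hF Δ hA]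
    exact (integral_re h_int.integrableOn).symm
  rw [← iSup_setIntegral_sub_setIntegral_compl (g := fun ω => (Δ * F ω).trace.re)
    (Complex.measurable_re.comp (measurable_trace_mul hm Δ)) h_int.re]
  refine iSup_congr fun A => ?_
  rw [Complex.sub_re]
  exact congrArg₂ _ (hre A.2) (hre A.2.compl)

theorem enorm_trace_mul_eq {A B : Matrix ι ι ℂ} (hA : A.IsHermitian) (hB : B.IsHermitian) :
    ‖(A * B).trace‖ₑ = ENNReal.ofReal |(A * B).trace.re| := by
  rw [← ofReal_norm, ← ofReal_re_trace_mul hA hB, Complex.norm_real, Real.norm_eq_abs,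
    Complex.ofReal_re]

theorem densityNorm_eq_ofReal_integral (hF : ∀ a b, Integrable (fun ω => F ω a b) μ)
    (hF_herm : ∀ ω, (F ω).IsHermitian) {Δ : Matrix ι ι ℂ} (hΔ : Δ.IsHermitian) :
    densityNorm μ F Δ = ENNReal.ofReal (∫ ω, |(Δ * F ω).trace.re| ∂μ) := by
  have hre : Integrable (fun ω => (Δ * F ω).trace.re) μ := (integrable_trace_mul hF Δ).re
  rw [ofReal_integral_eq_lintegral_ofReal hre.abs (.of_forall fun _ => abs_nonneg _)]
  exact lintegral_congr fun ω => enorm_trace_mul_eq hΔ (hF_herm ω)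

end OfDensity

theorem densityNorm_count {J ι : Type*} [Fintype J] [MeasurableSpace J]
    [MeasurableSingletonClass J] [Fintype ι] (M : J → Matrix ι ι ℂ) (Δ : Matrix ι ι ℂ) :
    densityNorm Measure.count M Δ = ENNReal.ofReal (discreteDistNorm M Δ) := by
  rw [densityNorm, lintegral_count, tsum_fintype, discreteDistNorm,
    ENNReal.ofReal_sum_of_nonneg fun _ _ => norm_nonneg _]
  simp only [ofReal_norm]

theorem pi_count {ι : Type*} [Fintype ι] {X : ι → Type*} [∀ i, Finite (X i)]
    [∀ i, MeasurableSpace (X i)] [∀ i, MeasurableSingletonClass (X i)] :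
    Measure.pi (fun i => (Measure.count : Measure (X i))) = Measure.count := by
  classical
  exact Measure.ext_iff_singleton.2 fun a => by simp [Measure.pi_singleton]

theorem measurable_smul_rankOne {d : ℕ} (a b : Fin d) :
    Measurable fun ψ : CSphere d => ((d : ℂ) • rankOne ψ.1) a b :=
  ((measurable_sphere_coord a).mul
    (continuous_star.measurable.comp (measurable_sphere_coord b))).const_mul _

theorem isHermitian_smul_rankOne {d : ℕ} (ψ : CSphere d) : ((d : ℂ) • rankOne ψ.1).IsHermitian :=
  (posSemidef_smul_rankOne ψ.1).isHermitian

theorem densityNorm_uniformSphere {d : ℕ} {Δ : Matrix (Fin d) (Fin d) ℂ} (hΔ : Δ.IsHermitian) :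
    densityNorm (uniformSphere d) (fun ψ => (d : ℂ) • rankOne ψ.1) Δ =
      ENNReal.ofReal (uniformNorm d Δ) := by
  rw [densityNorm_eq_ofReal_integral (F := fun ψ : CSphere d => (d : ℂ) • rankOne ψ.1)
    (fun a b => (integrable_rankOne a b).const_mul _) isHermitian_smul_rankOne hΔ,
    uniformNorm_apply]
  simp only [uniformDensity_apply, expect, Matrix.mul_smul, Matrix.trace_smul, smul_eq_mul,
    ← Complex.ofReal_natCast, Complex.re_ofReal_mul]

section LocalUniform

variable {k : ℕ} {d n : Fin k → ℕ} {Δ : Matrix (∀ i, Fin (d i)) (∀ i, Fin (d i)) ℂ}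

theorem distNorm_localUniformPOVM (Δ : Matrix (∀ i, Fin (d i)) (∀ i, Fin (d i)) ℂ) :
    (localUniformPOVM d).distNorm Δ
      = ∫ ψ, |(Δ * tensorMatrix fun i => (d i : ℂ) • rankOne (ψ i).1).trace.re|
        ∂(Measure.pi fun i => uniformSphere (d i)) :=
  POVM.distNorm_ofDensity _ _ _
    (measurable_tensorMatrix fun _ a b => measurable_smul_rankOne a b) Δ

theorem distNorm_localUniformPOVM_nonneg (Δ : Matrix (∀ i, Fin (d i)) (∀ i, Fin (d i)) ℂ) :
    0 ≤ (localUniformPOVM d).distNorm Δ :=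
  (integral_nonneg fun _ => abs_nonneg _).trans_eq (distNorm_localUniformPOVM Δ).symm

theorem densityNorm_pi_uniformSphere (hΔ : Δ.IsHermitian) :
    densityNorm (Measure.pi fun i => uniformSphere (d i))
      (fun ψ => tensorMatrix fun i => (d i : ℂ) • rankOne (ψ i).1) Δ =
      ENNReal.ofReal ((localUniformPOVM d).distNorm Δ) := by
  rw [distNorm_localUniformPOVM]
  refine densityNorm_eq_ofReal_integral
    (F := fun ψ : ∀ i, CSphere (d i) => tensorMatrix fun i => (d i : ℂ) • rankOne (ψ i).1)
    (fun a b => ?_) (fun ψ => isHermitian_tensorMatrix fun i => isHermitian_smul_rankOne _) hΔ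
  exact Integrable.fintype_prod_dep
    (f := fun i (ψ : CSphere (d i)) => ((d i : ℂ) • rankOne ψ.1) (a i) (b i))
    fun i => (integrable_rankOne (a i) (b i)).const_mul _

theorem densityNorm_pi_count (M : ∀ i, Fin (n i) → Matrix (Fin (d i)) (Fin (d i)) ℂ)
    (Δ : Matrix (∀ i, Fin (d i)) (∀ i, Fin (d i)) ℂ) :
    densityNorm (Measure.pi fun i => (Measure.count : Measure (Fin (n i))))
      (fun j => tensorMatrix fun i => M i (j i)) Δ =
      ENNReal.ofReal (discreteDistNorm (tensorFamily M) Δ) := by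
  rw [pi_count, densityNorm_count]
  rfl

variable {r : ℝ} {M : ∀ i, Fin (n i) → Matrix (Fin (d i)) (Fin (d i)) ℂ}

theorem discreteDistNorm_tensorFamily_le (hr : 0 ≤ r) (hM : ∀ i j, (M i j).IsHermitian)
    (h : ∀ i (Δ : Matrix (Fin (d i)) (Fin (d i)) ℂ), Δ.IsHermitian →
      discreteDistNorm (M i) Δ ≤ r * uniformNorm (d i) Δ) (hΔ : Δ.IsHermitian) :
    discreteDistNorm (tensorFamily M) Δ ≤ r ^ k * (localUniformPOVM d).distNorm Δ := by
  have hfactor (i) (Δ : Matrix (Fin (d i)) (Fin (d i)) ℂ) (hΔ : Δ.IsHermitian) :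
      densityNorm Measure.count (M i) Δ ≤ ENNReal.ofReal r *
        densityNorm (uniformSphere (d i)) (fun ψ => (d i : ℂ) • rankOne ψ.1) Δ := by
    rw [densityNorm_count, densityNorm_uniformSphere hΔ, ← ENNReal.ofReal_mul hr]
    exact ENNReal.ofReal_le_ofReal (h i Δ hΔ)
  have htensor := densityNorm_tensorMatrix_le (μ := fun i => Measure.count)
    (ν := fun i => uniformSphere (d i)) (F := M)
    (G := fun i (ψ : CSphere (d i)) => (d i : ℂ) • rankOne ψ.1)
    (fun i a b => measurable_of_finite _) (fun i => measurable_smul_rankOne) hM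
    (fun i => isHermitian_smul_rankOne) hfactor hΔ
  rwa [densityNorm_pi_count, densityNorm_pi_uniformSphere hΔ, ← ENNReal.ofReal_pow hr,
    ← ENNReal.ofReal_mul (by positivity), ENNReal.ofReal_le_ofReal_iff
    (mul_nonneg (by positivity) (distNorm_localUniformPOVM_nonneg Δ))] at htensor

theorem le_discreteDistNorm_tensorFamily (hr : 0 < r) (hM : ∀ i j, (M i j).IsHermitian)
    (h : ∀ i (Δ : Matrix (Fin (d i)) (Fin (d i)) ℂ), Δ.IsHermitian →
      r * uniformNorm (d i) Δ ≤ discreteDistNorm (M i) Δ) (hΔ : Δ.IsHermitian) :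
    r ^ k * (localUniformPOVM d).distNorm Δ ≤ discreteDistNorm (tensorFamily M) Δ := by
  have hfactor (i) (Δ : Matrix (Fin (d i)) (Fin (d i)) ℂ) (hΔ : Δ.IsHermitian) :
      densityNorm (uniformSphere (d i)) (fun ψ => (d i : ℂ) • rankOne ψ.1) Δ ≤
        ENNReal.ofReal r⁻¹ * densityNorm Measure.count (M i) Δ := by
    rw [densityNorm_count, densityNorm_uniformSphere hΔ, ← ENNReal.ofReal_mul (by positivity)]
    exact ENNReal.ofReal_le_ofReal ((le_inv_mul_iff₀ hr).2 (h i Δ hΔ))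
  have htensor := densityNorm_tensorMatrix_le (μ := fun i => uniformSphere (d i))
    (ν := fun i => Measure.count) (F := fun i (ψ : CSphere (d i)) => (d i : ℂ) • rankOne ψ.1)
    (G := M) (fun i => measurable_smul_rankOne)
    (fun i a b => measurable_of_finite _) (fun i => isHermitian_smul_rankOne) hM hfactor hΔ
  have hnonneg : 0 ≤ discreteDistNorm (tensorFamily M) Δ :=
    Finset.sum_nonneg fun _ _ => norm_nonneg _
  rwa [densityNorm_pi_count, densityNorm_pi_uniformSphere hΔ, ← ENNReal.ofReal_pow (by positivity),
    ← ENNReal.ofReal_mul (by positivity), ENNReal.ofReal_le_ofReal_iff (by positivity), inv_pow,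
    le_inv_mul_iff₀ (by positivity)] at htensor

theorem tensorFamily_normalizedFamily_spec [∀ i, NeZero (d i)] {ε : ℝ} (hn : ∀ i, 0 < n i)
    (hε0 : 0 ≤ ε) (hε1 : ε < 1) {ω : ∀ i, Fin (n i) → CSphere (d i)}
    (hω : ∀ i, IsApproximating (ε / 4096) (ω i)) :
    (∀ i, IsDiscretePOVM (normalizedFamily (ω i))) ∧
      ∀ Δ : Matrix (∀ i, Fin (d i)) (∀ i, Fin (d i)) ℂ, Δ.IsHermitian →
        (1 - ε) ^ k * (localUniformPOVM d).distNorm Δ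
            ≤ discreteDistNorm (tensorFamily fun i => normalizedFamily (ω i)) Δ ∧
        discreteDistNorm (tensorFamily fun i => normalizedFamily (ω i)) Δ
            ≤ (1 + ε) ^ k * (localUniformPOVM d).distNorm Δ := by
  have hspec i := normalizedFamily_spec (hn i) hε0 hε1.le (hω i)
  have hherm i j := ((hspec i).1.1 j).isHermitian
  refine ⟨fun i => (hspec i).1, fun Δ hΔ => ⟨?_, ?_⟩⟩
  · refine le_discreteDistNorm_tensorFamily (sub_pos.2 hε1) hherm (fun i A hA => ?_) hΔ
    linarith [(abs_le.1 ((hspec i).2 A hA)).1]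
  · refine discreteDistNorm_tensorFamily_le (by positivity) hherm (fun i A hA => ?_) hΔ
    linarith [(abs_le.1 ((hspec i).2 A hA)).2]

end LocalUniform

/-! ### Probability of failure -/

theorem log_one_add_two_pow_div_le {ε : ℝ} (hε0 : 0 < ε) (hε1 : ε ≤ 1) (m : ℕ) :
    Real.log (1 + 2 ^ m / ε) ≤ m + 1 + |Real.log ε| := by
  have hle : 1 + 2 ^ m / ε ≤ 2 ^ (m + 1) / ε := by
    rw [pow_succ, mul_two, add_div]
    gcongr
    exact (one_le_div hε0).2 (hε1.trans (one_le_pow₀ one_le_two))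
  calc Real.log (1 + 2 ^ m / ε) ≤ Real.log (2 ^ (m + 1) / ε) :=
        Real.log_le_log (by positivity) hle
    _ = (m + 1) * Real.log 2 - Real.log ε := by
        rw [Real.log_div (by positivity) hε0.ne', Real.log_pow, Nat.cast_succ]
    _ ≤ (m + 1) * 1 + |Real.log ε| := by
        rw [sub_eq_add_neg]
        gcongr
        · exact Real.log_two_lt_d9.le.trans (by norm_num)
        · exact neg_le_abs _
    _ = m + 1 + |Real.log ε| := by rw [mul_one]

theorem measure_not_isApproximating_lt {d n : ℕ} [NeZero d] {ε : ℝ} (hε0 : 0 < ε) (hε1 : ε ≤ 1)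
    (hn : 2 ^ 47 * ε⁻¹ ^ 2 * max 1 |Real.log ε| * (d : ℝ) ^ 2 ≤ n) :
    (Measure.pi fun _ : Fin n => uniformSphere d).real {ω | ¬ IsApproximating (ε / 4096) ω}
      < Real.exp (-d) := by
  set L := max 1 |Real.log ε|
  have hd : (1 : ℝ) ≤ d := Nat.one_le_cast.2 (NeZero.pos d)
  have hL : 1 ≤ L := le_max_left _ _
  have hn0 : 0 < n := Nat.cast_pos.1 (lt_of_lt_of_le (by positivity) hn)
  have hfail := measure_not_isApproximating_le (d := d) hn0 (η := ε / 2 ^ 14) (by positivity)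
    (by linarith)
  rw [show 4 * (ε / 2 ^ 14) = ε / 4096 by ring, ← div_mul, mul_comm (2 / ε), ← mul_div_assoc,
    ← pow_succ] at hfail
  have hlog : Real.log (1 + 2 ^ 15 / ε) ≤ 17 * L :=
    (log_one_add_two_pow_div_le hε0 hε1 15).trans
      (by push_cast; linarith [le_max_right 1 |Real.log ε|])
  have hsample : 64 * (d ^ 2 * L) ≤ n * (ε / 2 ^ 14) ^ 2 / 8192 := by
    calc 64 * (d ^ 2 * L) = 2 ^ 47 * ε⁻¹ ^ 2 * L * d ^ 2 * ((ε / 2 ^ 14) ^ 2 / 8192) := by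
          field_simp
          norm_num
      _ ≤ n * ((ε / 2 ^ 14) ^ 2 / 8192) := by gcongr
      _ = _ := (mul_div_assoc _ _ _).symm
  have hdL : d ≤ d ^ 2 * L := by nlinarith
  calc _ ≤ 4 * (1 + 2 ^ 15 / ε) ^ (2 * d ^ 2) * Real.exp (-(n * (ε / 2 ^ 14) ^ 2 / 8192)) := hfail
    _ ≤ Real.exp 3 * Real.exp (17 * L) ^ (2 * d ^ 2) * Real.exp (-(64 * (d ^ 2 * L))) := by
        gcongr
        · exact (by norm_num : (4 : ℝ) = 3 + 1).trans_le (Real.add_one_le_exp 3)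
        · exact (Real.log_le_iff_le_exp (by positivity)).1 hlog
    _ = Real.exp (3 - 30 * (d ^ 2 * L)) := by
        rw [← Real.exp_nat_mul, ← Real.exp_add, ← Real.exp_add]
        congr 1
        push_cast
        ring
    _ < Real.exp (-d) := Real.exp_lt_exp.2 (by linarith)

section Independence

variable {ι : Type*} {J : ι → Type*} {X : ι → Type*} [Fintype ι] [∀ i, Fintype (J i)]
  [∀ i, MeasurableSpace (X i)] {μ : ∀ i, Measure (X i)} [∀ i, IsProbabilityMeasure (μ i)]
  {Ω : Type*} [MeasurableSpace Ω] {P : Measure Ω} {ψ : ∀ i, J i → Ω → X i}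

theorem hasLaw_curry_of_iIndepFun [IsProbabilityMeasure P] (hlaw : ∀ i j, HasLaw (ψ i j) (μ i) P)
    (hind : iIndepFun (fun p : Σ i, J i => ψ p.1 p.2) P) :
    HasLaw (fun ω i j => ψ i j ω) (Measure.pi fun i => Measure.pi fun _ : J i => μ i) P := by
  have hcurry : HasLaw (MeasurableEquiv.piCurry fun i (_ : J i) => X i)
      (Measure.pi fun i => Measure.pi fun _ : J i => μ i)
      (Measure.pi fun p : Σ i, J i => μ p.1) :=
    ⟨(MeasurableEquiv.measurable _).aemeasurable, by
      simpa only [Measure.infinitePi_eq_pi] using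
        Measure.infinitePi_map_piCurry fun i (_ : J i) => μ i⟩
  exact hcurry.comp (hind.hasLaw_pi fun p => hlaw p.1 p.2)

theorem measure_exists_notMem_le {Y : ι → Type*} [∀ i, MeasurableSpace (Y i)]
    {ν : ∀ i, Measure (Y i)} [∀ i, IsProbabilityMeasure (ν i)] {Z : Ω → ∀ i, Y i}
    (hZ : HasLaw Z (Measure.pi ν) P) (G : ∀ i, Set (Y i)) :
    P.real {ω | ∃ i, Z ω i ∉ G i} ≤ 1 - ∏ i, (1 - (ν i).real (G i)ᶜ) := by
  let N i := toMeasurable (ν i) (G i)ᶜ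
  have hN i : MeasurableSet (N i) := measurableSet_toMeasurable _ _
  have hsub : {ω | ∃ i, Z ω i ∉ G i} ⊆ Z ⁻¹' (Set.univ.pi fun i => (N i)ᶜ)ᶜ := by
    rintro ω ⟨i, hi⟩ hmem
    exact hmem i (Set.mem_univ i) (subset_toMeasurable _ _ hi)
  have hle : P {ω | ∃ i, Z ω i ∉ G i} ≤ Measure.pi ν (Set.univ.pi fun i => (N i)ᶜ)ᶜ := by
    rw [← hZ.map_eq]
    exact (measure_mono hsub).trans (Measure.le_map_apply hZ.aemeasurable _)
  have hprod : (Measure.pi ν).real (Set.univ.pi fun i => (N i)ᶜ)ᶜ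
      = 1 - ∏ i, (1 - (ν i).real (G i)ᶜ) := by
    rw [probReal_compl_eq_one_sub (.univ_pi fun i => (hN i).compl), measureReal_def,
      Measure.pi_pi, ENNReal.toReal_prod]
    congr! 2 with i
    rw [← measureReal_def, probReal_compl_eq_one_sub (hN i), measureReal_def,
      measure_toMeasurable, ← measureReal_def]
  exact (ENNReal.toReal_mono (measure_ne_top _ _) hle).trans_eq hprod

end Independence

end

theorem theorem5p3 :
    ∃ C : ℝ, 0 < C ∧ ∀ ε : ℝ, 0 < ε → ε < 1 → ∃ c : ℝ, 0 < c ∧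
      ∀ (k : ℕ) (d n : Fin k → ℕ), 1 ≤ k → (∀ i, 1 ≤ d i) →
        (∀ i, C * ε⁻¹ ^ 2 * max 1 |Real.log ε| * (d i : ℝ) ^ 2 ≤ n i) →
      ∀ {Ω : Type*} [MeasurableSpace Ω] (P : Measure Ω) [IsProbabilityMeasure P]
        (ψ : ∀ i, Fin (n i) → Ω → CSphere (d i)),
        (∀ i j, HasLaw (ψ i j) (uniformSphere (d i)) P) →
        iIndepFun (fun (p : Σ i, Fin (n i)) => ψ p.1 p.2) P →
        P.real {ω | ¬ ((∀ i, IsDiscretePOVM (normalizedFamily fun j => ψ i j ω)) ∧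
          ∀ Δ : Matrix (∀ i, Fin (d i)) (∀ i, Fin (d i)) ℂ, Δ.IsHermitian →
            (1 - ε) ^ k * (localUniformPOVM d).distNorm Δ
                ≤ discreteDistNorm (tensorFamily fun i => normalizedFamily fun j => ψ i j ω) Δ ∧
            discreteDistNorm (tensorFamily fun i => normalizedFamily fun j => ψ i j ω) Δ
                ≤ (1 + ε) ^ k * (localUniformPOVM d).distNorm Δ)}
          < 1 - ∏ i, (1 - Real.exp (-(c * d i))) := by
  refine ⟨2 ^ 47, by norm_num, fun ε hε0 hε1 => ⟨1, one_pos, ?_⟩⟩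
  intro k d n hk hd hn Ω _ P _ ψ hlaw hind
  have hd_ne i : NeZero (d i) := ⟨Nat.one_le_iff_ne_zero.1 (hd i)⟩
  have hn_pos i : 0 < n i := by
    have hd_pos : (0 : ℝ) < d i := Nat.cast_pos.2 (hd i)
    exact Nat.cast_pos.1 (lt_of_lt_of_le (by positivity) (hn i))
  have hfail i := measure_not_isApproximating_lt hε0 hε1.le (hn i)
  have hsome_fails := measure_exists_notMem_le (hasLaw_curry_of_iIndepFun hlaw hind)
    fun i => {ω | IsApproximating (ε / 4096) ω}
  refine lt_of_le_of_lt ((measureReal_mono fun ω hω => ?_).trans hsome_fails) ?_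
  · by_contra hgood
    exact hω (tensorFamily_normalizedFamily_spec hn_pos hε0.le hε1 fun i =>
      not_not.1 fun hi => hgood ⟨i, hi⟩)
  · simp only [one_mul]
    refine sub_lt_sub_left (Finset.prod_lt_prod_of_nonempty (fun i _ => ?_)
      (fun i _ => sub_lt_sub_left (hfail i) 1) ⟨⟨0, hk⟩, Finset.mem_univ _⟩) 1
    exact sub_pos.2 (Real.exp_lt_one_iff.2 (neg_lt_zero.2 (Nat.cast_pos.2 (hd i))))
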